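/- **Theorem (Correctness of FFJ$_{PL}$).** Let $pl=(t,CT,IT,RT,FM)$ be a product line that is well-typed in FFJ$_{PL}$, and let $fs$ be a list of features whose combination is legal in $FM$. Then the derived program $derive(pl,fs)$ is a well-typed FFJ program. The same holds if the typing rule for stupid casts (casts between unrelated types) is removed from both type systems. The notions are the following. *Syntax.* Terms are those of Featherweight Java: $x$, $t.f$, $t.m(\bar t)$, $\mathsf{new}\ C(\bar t)$, $(C)t$. A class declaration $\mathsf{class}\ C\ \mathsf{extends}\ D\{\bar C\,\bar f;\ \bar M\}$ or a refinement $\mathsf{refines\ class}\ C\{\bar C\,\bar f;\ \bar M\}$ belongs to a feature; a method may carry the modifier $\mathsf{overrides}$. The class table $CT$ is a finite partial map from pairs $\Phi.C$ (feature, class name) to declarations, and the refinement table lists in $RT(C)$, in composition order, the features that introduce or refine $C$. $last(C)$ is $\Phi.C$ for the last $\Phi$ in $RT(C)$; $pred(\Phi.C)$ is $\Psi.C$ for the predecessor $\Psi$ of $\Phi$ in $RT(C)$, and $Base.Object$ if there is none; $last(Object)=Base.Object$, where lookups end. *FFJ.* Subtyping $<:$ is the reflexive and transitive closure of direct inheritance.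 $fields$ and $mtype$ search the refinement chain from right to left and then the chain of the superclass. Terms are typed as in Featherweight Java, with $fields(last(C))$ and $mtype(m,last(C))$. A program $(t,CT,RT)$ is well-typed if: $t$ has a type in the empty context; in every declaration each method body has a subtype of the declared result type; a method without $\mathsf{overrides}$ is not found by $mtype$ from $last$ of the superclass (in a class) or from $pred$ (in a refinement), and a method with $\mathsf{overrides}$ is found there with the same signature; no declared field is already found there by $fields$; a class is introduced by no other feature; a refinement is preceded in its chain by a declaration of the class; and the tables are sane: declarations are stored under their own class names, $Object$ is not declared, every other class name occurring in $CT$ is in the domain of $CT$, lists of fields, methods and parameters have no duplicate names, inheritance is acyclic, and $RT(C)$ lists, without repetition and in an order common to all classes, exactly the features with an entry for $C$, the introducing one first and refining ones after it. *Feature models.* $FM$ is an ordered list of features with a set of legal combinations (finite sets of these features). A variant of a context $\bar\Omega$ is a legal combination that contains $\bar\Omega$. $never(\bar\Omega,\Phi)$, $sometimes(\bar\Omega,\Phi)$: no, respectively some, variant of $\bar\Omega$ contains $\Phi$. $always(\bar\Omega,\Phi)$ is $\Phi$ if all variants of $\bar\Omega$ contain $\Phi$; it is a list $G\ni\Phi$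 if in the context $\bar\Omega$ the features of $G$ are optional, exclude each other, and one of them is always present; it is empty if neither is possible (where several $G$ qualify, any may be used). $validref(\bar\Omega,e)$, for a class, a field of a class or a method of a class: in every variant of $\bar\Omega$, $e$ is introduced (for members: or inherited) by present features. *FFJ$_{PL}$.* $C<:E\dashv\bar\Omega$ holds if $C=E$, or if $C\neq Object$, $validref(\bar\Omega,C)$, and for every declaration of $C$ in a feature $\Psi$ with $sometimes(\bar\Omega,\Psi)$ its superclass $D$ satisfies $validref((\bar\Omega,\Psi),D)$ and $D<:E\dashv\bar\Omega,\Psi$. $fields(\bar\Omega,\cdot)$ yields a list of alternative field lists: a feature that is never present is skipped, the fields of an always present one are appended, those of one with $always=\bullet$ are appended with the marker $@$, and for a group of alternatives the lookup is repeated with each member added to the context and the results are concatenated. $mtype(\bar\Omega,m,\cdot)$ lists all signatures of $m$ in sometimes present declarations, searching all predecessors and all superclasses. Judgments $\Gamma\vdash t:\bar C\dashv\bar\Omega$ assign to $t$ the list of its possible types. A variable has its declared type. For $t_0.f$ and $t_0.m(\bar t)$, with $t_0:\bar E$, the member must satisfy $validref$ for every $E\in\bar E$; every list in $fields(\bar\Omega,last(E))$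 must contain $f$, respectively all possible argument types must be subtypes in the context of the parameter types of every signature in $mtype(\bar\Omega,m,last(E))$ (with equal lengths); the possible types are all those of $f$, respectively all result types. For $\mathsf{new}\ C(\bar t)$: $validref(\bar\Omega,C)$, and every list in $fields(\bar\Omega,last(C))$ is free of $@$, has the length of $\bar t$, and has types that are supertypes in the context of all possible argument types. For $(C)t_0$: $validref(\bar\Omega,C)$, and each possible type of $t_0$ is a sub- or supertype of $C$ in the context (otherwise the cast is stupid). The possible type of the last two is $C$. $pl$ is well-typed if: $t$ is typable in the empty typing context and empty feature context; in every declaration in a feature $\Phi$, in the context $\Phi$, all possible types of each method body are subtypes of the declared result type; all parameter, result, field and superclass types satisfy $validref$; a method without $\mathsf{overrides}$ has an empty $mtype$ from $last$ of the superclass (in a class) or from $pred$ (in a refinement), a method with $\mathsf{overrides}$ is always reachable there and all signatures found are its own; no declared field is in a list found there by $fields$; no other feature that is sometimes present with $\Phi$ introduces the same class; a refined class is always introduced by a preceding feature of its chain; $CT$ is sane as above, except that inheritance has to be acyclic only within the declarations of each legal combination; and $RT$, and $IT$ for classes, fields and methods, list in the order of $FM$ exactly the features that introduce or refine the class, respectively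 introduce the class, field or method. $derive(pl,fs)$ has the term $t$, the entries of $CT$ for the features in $fs$, and the lists $RT(C)$ restricted to $fs$. -/

import Mathlib

/-! ## Syntax of FFJ -/

namespace FFJ

abbrev Feature := String
abbrev FieldName := String
abbrev MethodName := String

inductive ClassName where
  | object : ClassName
  | named : String → ClassName
  deriving DecidableEq

inductive Var where
  | this : Var
  | named : String → Var

inductive Term where
  | var : Var → Term
  | field : Term → FieldName → Term
  | invk : Term → MethodName → List Term → Term
  | new : ClassName → List Term → Term
  | cast : ClassName → Term → Term

structure FieldDecl where
  ty : ClassName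
  name : FieldName

/-- The type of a method: parameter types and result type. -/
structure Sig where
  params : List ClassName
  ret : ClassName

/-- `[overrides] ret name (params) { return body; }`; a parameter is a type with a name. -/
structure MethodDecl where
  overrides : Bool
  ret : ClassName
  name : MethodName
  params : List (ClassName × String)
  body : Term

def MethodDecl.sig (M : MethodDecl) : Sig := ⟨M.params.map Prod.fst, M.ret⟩

/-- `class name extends super { fields; methods }` -/
structure ClassDecl where
  name : ClassName
  super : ClassName
  fields : List FieldDecl
  methods : List MethodDecl

/-- `refines class name { fields; methods }` -/
structure RefDecl where
  name : ClassName
  fields : List FieldDecl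
  methods : List MethodDecl

inductive Decl where
  | cls : ClassDecl → Decl
  | ref : RefDecl → Decl

def Decl.name : Decl → ClassName
  | .cls L => L.name
  | .ref R => R.name

def Decl.fields : Decl → List FieldDecl
  | .cls L => L.fields
  | .ref R => R.fields

def Decl.methods : Decl → List MethodDecl
  | .cls L => L.methods
  | .ref R => R.methods

/-- The class name `A` occurs in a term. -/
inductive Term.Mentions (A : ClassName) : Term → Prop
  | field {t f} : Term.Mentions A t → Term.Mentions A (.field t f)
  | invk {t m ts} : Term.Mentions A t → Term.Mentions A (.invk t m ts)
  | invkArg {t m ts u} : u ∈ ts → Term.Mentions A u → Term.Mentions A (.invk t m ts)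
  | new {ts} : Term.Mentions A (.new A ts)
  | newArg {C ts u} : u ∈ ts → Term.Mentions A u → Term.Mentions A (.new C ts)
  | cast {t} : Term.Mentions A (.cast A t)
  | castArg {C t} : Term.Mentions A t → Term.Mentions A (.cast C t)

/-- The class name `A` occurs in a method declaration. -/
def MethodDecl.Mentions (A : ClassName) (M : MethodDecl) : Prop :=
  M.ret = A ∨ A ∈ M.sig.params ∨ M.body.Mentions A

/-- The class name `A` occurs in a class or refinement declaration. -/
def Decl.Mentions (A : ClassName) (d : Decl) : Prop :=
  d.name = A ∨ (∃ L, d = .cls L ∧ L.super = A) ∨ (∃ F ∈ d.fields, F.ty = A) ∨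
    ∃ M ∈ d.methods, M.Mentions A

/-- The lists of field declarations, of method declarations and of parameter names
have no duplicates. -/
def Decl.NoDuplicates (d : Decl) : Prop :=
  (d.fields.map FieldDecl.name).Nodup ∧ (d.methods.map MethodDecl.name).Nodup ∧
    ∀ M ∈ d.methods, (M.params.map Prod.snd).Nodup

/-! ## Class and refinement tables -/

/-- `ct Φ C` is the class or refinement declaration of the qualified type `Φ.C`, if any. -/
abbrev ClassTable := Feature → ClassName → Option Decl

/-- `rt C` lists the features that introduce or refine `C`, in composition order. -/
abbrev RefTable := ClassName → List Feature

/-- Qualified types: `Base.Object`, at which lookups end, or `Φ.C`. -/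
inductive QType where
  | baseObject : QType
  | mk : Feature → ClassName → QType

/-- `last(C)`; it is undefined for a class other than `Object` that no feature mentions. -/
def last (rt : RefTable) (C : ClassName) : Option QType :=
  if C = .object then some .baseObject else (rt C).getLast?.map fun Ψ => .mk Ψ C

/-- The features that precede `Φ` in the refinement chain of `C`. -/
def before (rt : RefTable) (Φ : Feature) (C : ClassName) : List Feature :=
  (rt C).takeWhile fun Ψ => Ψ ≠ Φ

/-- `pred(Φ.C)` -/
def pred (rt : RefTable) (Φ : Feature) (C : ClassName) : QType :=
  match (before rt Φ C).getLast? with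
  | none => .baseObject
  | some Ψ => .mk Ψ C

/-- Some feature declares `C` as a direct subclass of `D`. -/
def DirectSuper (ct : ClassTable) (C D : ClassName) : Prop :=
  ∃ Φ L, ct Φ C = some (.cls L) ∧ L.super = D

/-- The inheritance relation has no cycles (including self-cycles). -/
def Acyclic (ct : ClassTable) : Prop :=
  ∀ C, ¬ Relation.TransGen (DirectSuper ct) C C

/-- The sanity conditions on a class table other than acyclicity of inheritance. -/
structure TableSane (ct : ClassTable) : Prop where
  finite : {p : Feature × ClassName | ct p.1 p.2 ≠ none}.Finite
  name_eq : ∀ Φ C d, ct Φ C = some d → d.name = C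
  object_undeclared : ∀ Φ, ct Φ .object = none
  closed : ∀ Φ C d, ct Φ C = some d → ∀ A, d.Mentions A → A = .object ∨ ∃ Ψ, ct Ψ A ≠ none
  noDuplicates : ∀ Φ C d, ct Φ C = some d → d.NoDuplicates

/-! ## FFJ programs and their type system -/

structure Program where
  term : Term
  ct : ClassTable
  rt : RefTable

/-- Typing contexts. -/
abbrev Ctx := List (Var × ClassName)

/-- The context `x̄ : B̄, this : C` of a method body in class `C`. -/
def MethodDecl.ctx (M : MethodDecl) (C : ClassName) : Ctx :=
  M.params.map (fun p => (Var.named p.2, p.1)) ++ [(.this, C)]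

namespace Program

variable (P : Program)

/-- Subtyping. -/
inductive Sub : ClassName → ClassName → Prop
  | refl (C) : Sub C C
  | trans {C D E} : Sub C D → Sub D E → Sub C E
  | extend {Φ C L} : P.ct Φ C = some (.cls L) → Sub C L.super

/-- `fields(q) = fs`: refinement chain from right to left, then the superclass. -/
inductive Fields : QType → List FieldDecl → Prop
  | base : Fields .baseObject []
  | cls {Φ C L q fs} : P.ct Φ C = some (.cls L) → last P.rt L.super = some q → Fields q fs →
      Fields (.mk Φ C) (fs ++ L.fields)
  | ref {Φ C R fs} : P.ct Φ C = some (.ref R) → Fields (pred P.rt Φ C) fs →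
      Fields (.mk Φ C) (fs ++ R.fields)

/-- `mtype(m, q) = σ` -/
inductive Mtype (m : MethodName) : QType → Sig → Prop
  | here {Φ C d M} : P.ct Φ C = some d → M ∈ d.methods → M.name = m → Mtype m (.mk Φ C) M.sig
  | cls {Φ C L q σ} : P.ct Φ C = some (.cls L) → (∀ M ∈ L.methods, M.name ≠ m) →
      last P.rt L.super = some q → Mtype m q σ → Mtype m (.mk Φ C) σ
  | ref {Φ C R σ} : P.ct Φ C = some (.ref R) → (∀ M ∈ R.methods, M.name ≠ m) →
      Mtype m (pred P.rt Φ C) σ → Mtype m (.mk Φ C) σ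

/-- No feature other than `Φ` introduces the class `C`. -/
def IntroduceClass (Φ : Feature) (C : ClassName) : Prop :=
  ∀ Ψ, Ψ ≠ Φ → ¬ ∃ L, P.ct Ψ C = some (.cls L)

def IntroduceField (f : FieldName) (q : QType) : Prop :=
  ∃ fs, P.Fields q fs ∧ ∀ F ∈ fs, F.name ≠ f

def IntroduceMethod (m : MethodName) (q : QType) : Prop :=
  ¬ ∃ σ, P.Mtype m q σ

/-- The class `C` is declared previously in the refinement chain. -/
def Refine (Φ : Feature) (C : ClassName) : Prop :=
  ∃ Ψ ∈ before P.rt Φ C, ∃ L, P.ct Ψ C = some (.cls L)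

def Override (m : MethodName) (q : QType) (σ : Sig) : Prop :=
  P.Mtype m q σ

/-- Term typing `Γ ⊢ t : C`. The rule for stupid casts is available if `stupid = true`. -/
inductive HasType (stupid : Bool) (Γ : Ctx) : Term → ClassName → Prop
  | var {x C} : (x, C) ∈ Γ → HasType stupid Γ (.var x) C
  | field {t₀ C₀ q fs F} : HasType stupid Γ t₀ C₀ → last P.rt C₀ = some q → P.Fields q fs →
      F ∈ fs → HasType stupid Γ (.field t₀ F.name) F.ty
  | invk {t₀ C₀ q m σ ts Cs} : HasType stupid Γ t₀ C₀ → last P.rt C₀ = some q →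
      P.Mtype m q σ → ts.length = Cs.length →
      (∀ p ∈ ts.zip Cs, HasType stupid Γ p.1 p.2) →
      Cs.length = σ.params.length → (∀ p ∈ Cs.zip σ.params, P.Sub p.1 p.2) →
      HasType stupid Γ (.invk t₀ m ts) σ.ret
  | new {C q fs ts Cs} : last P.rt C = some q → P.Fields q fs → ts.length = Cs.length →
      (∀ p ∈ ts.zip Cs, HasType stupid Γ p.1 p.2) →
      Cs.length = fs.length → (∀ p ∈ Cs.zip fs, P.Sub p.1 p.2.ty) →
      HasType stupid Γ (.new C ts) C
  | ucast {t₀ D C} : HasType stupid Γ t₀ D → P.Sub D C → HasType stupid Γ (.cast C t₀) C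
  | dcast {t₀ D C} : HasType stupid Γ t₀ D → P.Sub C D → C ≠ D →
      HasType stupid Γ (.cast C t₀) C
  | scast {t₀ D C} : stupid = true → HasType stupid Γ t₀ D → ¬ P.Sub C D → ¬ P.Sub D C →
      HasType stupid Γ (.cast C t₀) C

/-- The body of `M`, declared in class `C`, has a subtype of the declared result type. -/
def BodyOK (stupid : Bool) (C : ClassName) (M : MethodDecl) : Prop :=
  ∃ E₀, P.HasType stupid (M.ctx C) M.body E₀ ∧ P.Sub E₀ M.ret

/-- Well-formedness of methods, `M OK ⊣ Φ.C`. -/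
inductive MethodOK (stupid : Bool) (Φ : Feature) (C : ClassName) (M : MethodDecl) : Prop
  | clsIntro {L q} : P.BodyOK stupid C M → P.ct Φ C = some (.cls L) → M.overrides = false →
      last P.rt L.super = some q → P.IntroduceMethod M.name q → MethodOK stupid Φ C M
  | clsOverride {L q} : P.BodyOK stupid C M → P.ct Φ C = some (.cls L) → M.overrides = true →
      last P.rt L.super = some q → P.Override M.name q M.sig → MethodOK stupid Φ C M
  | refIntro {R} : P.BodyOK stupid C M → P.ct Φ C = some (.ref R) → M.overrides = false →
      P.IntroduceMethod M.name (pred P.rt Φ C) → MethodOK stupid Φ C M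
  | refOverride {R} : P.BodyOK stupid C M → P.ct Φ C = some (.ref R) → M.overrides = true →
      P.Override M.name (pred P.rt Φ C) M.sig → MethodOK stupid Φ C M

/-- `L OK ⊣ Φ` -/
structure ClassOK (stupid : Bool) (Φ : Feature) (L : ClassDecl) : Prop where
  methods : ∀ M ∈ L.methods, P.MethodOK stupid Φ L.name M
  fields : ∃ q, last P.rt L.super = some q ∧ ∀ F ∈ L.fields, P.IntroduceField F.name q
  introduce : P.IntroduceClass Φ L.name

/-- `R OK ⊣ Φ` -/
structure RefOK (stupid : Bool) (Φ : Feature) (R : RefDecl) : Prop where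
  methods : ∀ M ∈ R.methods, P.MethodOK stupid Φ R.name M
  fields : ∀ F ∈ R.fields, P.IntroduceField F.name (pred P.rt Φ R.name)
  refine : P.Refine Φ R.name

/-- The sanity conditions on the refinement table: `rt C` lists without repetition the features
that introduce and refine `C`, in the order of composition, the introducing one first. -/
structure RefTableSane : Prop where
  mem_iff : ∀ Φ C, Φ ∈ P.rt C ↔ P.ct Φ C ≠ none
  ordered : ∃ order : List Feature, order.Nodup ∧ ∀ C, (P.rt C).Sublist order
  shape : ∀ C Φ Ψs, P.rt C = Φ :: Ψs →
    (∃ L, P.ct Φ C = some (.cls L)) ∧ ∀ Ψ ∈ Ψs, ∃ R, P.ct Ψ C = some (.ref R)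

/-- Well-typed FFJ programs. With `stupid = true` all term typing rules may be used, with
`stupid = false` all but the one for stupid casts. -/
structure WellTyped (stupid : Bool) : Prop where
  term : ∃ C, P.HasType stupid [] P.term C
  classes : ∀ Φ C L, P.ct Φ C = some (.cls L) → P.ClassOK stupid Φ L
  refinements : ∀ Φ C R, P.ct Φ C = some (.ref R) → P.RefOK stupid Φ R
  table : TableSane P.ct
  acyclic : Acyclic P.ct
  refTable : P.RefTableSane

end Program

/-! ## Feature models -/

/-- An ordered set of features with the set of its legal combinations. -/
structure FeatureModel where
  features : List Feature
  nodup : features.Nodup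
  legal : Set (Finset Feature)
  legal_subset : ∀ s ∈ legal, ∀ Φ ∈ s, Φ ∈ features

namespace FeatureModel

variable (fm : FeatureModel)

/-- A list of features is a valid selection if their combination is legal. -/
def Valid (fs : List Feature) : Prop := fs.toFinset ∈ fm.legal

/-- `s` is a legal combination that contains all features of the context `Ω`. -/
def Variant (Ω : List Feature) (s : Finset Feature) : Prop :=
  s ∈ fm.legal ∧ ∀ Ψ ∈ Ω, Ψ ∈ s

/-- No variant with `Ω` contains `Φ`. -/
def Never (Ω : List Feature) (Φ : Feature) : Prop := ∀ s, fm.Variant Ω s → Φ ∉ s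

/-- Some variant with `Ω` contains `Φ`. -/
def Sometimes (Ω : List Feature) (Φ : Feature) : Prop := ∃ s, fm.Variant Ω s ∧ Φ ∈ s

/-- Every variant with `Ω` contains `Φ`. -/
def Mandatory (Ω : List Feature) (Φ : Feature) : Prop := ∀ s, fm.Variant Ω s → Φ ∈ s

/-- In the context `Ω`, the features in `G` are optional and exclude each other, and one of them
is always present. -/
structure Alternatives (Ω G : List Feature) : Prop where
  nodup : G.Nodup
  optional : ∀ Φ ∈ G, fm.Sometimes Ω Φ ∧ ¬ fm.Mandatory Ω Φ
  exclusive : ∀ Φ ∈ G, ∀ Ψ ∈ G, Φ ≠ Ψ → fm.Never (Φ :: Ω) Ψ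
  exhaustive : ∀ s, fm.Variant Ω s → ∃ Φ ∈ G, Φ ∈ s

/-- `always(Ω, Φ) = G`: the feature itself, a group of alternatives that contains it, or,
failing both, the empty list. -/
inductive Always (Ω : List Feature) (Φ : Feature) : List Feature → Prop
  | alone : fm.Mandatory Ω Φ → Always Ω Φ [Φ]
  | group {G} : fm.Alternatives Ω G → Φ ∈ G → Always Ω Φ G
  | none : ¬ fm.Mandatory Ω Φ → (¬ ∃ G, fm.Alternatives Ω G ∧ Φ ∈ G) → Always Ω Φ []

end FeatureModel

/-! ## Product lines and the type system of FFJ_PL -/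

/-- For classes, fields of a class and methods of a class: the features that introduce them. -/
structure IntroTable where
  cls : ClassName → List Feature
  field : ClassName → FieldName → List Feature
  method : ClassName → MethodName → List Feature

structure ProductLine where
  term : Term
  ct : ClassTable
  it : IntroTable
  rt : RefTable
  fm : FeatureModel

/-- The declarations that belong to the features in `s`. -/
def ClassTable.select (ct : ClassTable) (s : Finset Feature) : ClassTable :=
  fun Φ C => if Φ ∈ s then ct Φ C else none

/-- A field, and whether it carries the marker `@` of a field that may be absent. -/
abbrev MarkedField := FieldDecl × Bool

/-- Add fields with a given marker to each inner list. -/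
def appendFields (R : List (List MarkedField)) (fs : List FieldDecl) (mark : Bool) :
    List (List MarkedField) :=
  R.map fun l => l ++ fs.map fun F => (F, mark)

namespace ProductLine

variable (pl : ProductLine)

/-- The program that consists of the selected feature modules. -/
def derive (fs : List Feature) : Program where
  term := pl.term
  ct := ClassTable.select pl.ct fs.toFinset
  rt := fun C => (pl.rt C).filter fun Φ => Φ ∈ fs.toFinset

/-- `validref(Ω, C) ⊣ Ψs`: in every variant with `Ω`, one of the features `Ψs` is present and
introduces `C`. -/
def ValidClassIn (Ω Ψs : List Feature) (C : ClassName) : Prop :=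
  C = .object ∨ ∀ s, pl.fm.Variant Ω s → ∃ Ψ ∈ Ψs, Ψ ∈ s ∧ Ψ ∈ pl.it.cls C

/-- `validref(Ω, C)` -/
def ValidClass (Ω : List Feature) (C : ClassName) : Prop :=
  pl.ValidClassIn Ω (pl.it.cls C) C

/-- In the variant `s`, field `f` is introduced in class `C` by one of the features `Ψs`, or
inherited by a declaration of `C` in one of them. -/
inductive FieldPresent (s : Finset Feature) (f : FieldName) : List Feature → ClassName → Prop
  | own {Ψs C Ψ} : Ψ ∈ Ψs → Ψ ∈ s → Ψ ∈ pl.it.field C f → FieldPresent s f Ψs C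
  | inherited {Ψs C Ψ L} : Ψ ∈ Ψs → Ψ ∈ s → pl.ct Ψ C = some (.cls L) →
      FieldPresent s f (pl.rt L.super) L.super → FieldPresent s f Ψs C

/-- In the variant `s`, method `m` is introduced in class `C` by one of the features `Ψs`, or
inherited by a declaration of `C` in one of them. -/
inductive MethodPresent (s : Finset Feature) (m : MethodName) : List Feature → ClassName → Prop
  | own {Ψs C Ψ} : Ψ ∈ Ψs → Ψ ∈ s → Ψ ∈ pl.it.method C m → MethodPresent s m Ψs C
  | inherited {Ψs C Ψ L} : Ψ ∈ Ψs → Ψ ∈ s → pl.ct Ψ C = some (.cls L) →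
      MethodPresent s m (pl.rt L.super) L.super → MethodPresent s m Ψs C

/-- `validref(Ω, C.f)` -/
def ValidField (Ω : List Feature) (C : ClassName) (f : FieldName) : Prop :=
  ∀ s, pl.fm.Variant Ω s → pl.FieldPresent s f (pl.rt C) C

/-- `validref(Ω, C.m) ⊣ Ψs` -/
def ValidMethodIn (Ω Ψs : List Feature) (C : ClassName) (m : MethodName) : Prop :=
  ∀ s, pl.fm.Variant Ω s → pl.MethodPresent s m Ψs C

/-- `validref(Ω, C.m)` -/
def ValidMethod (Ω : List Feature) (C : ClassName) (m : MethodName) : Prop :=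
  pl.ValidMethodIn Ω (pl.rt C) C m

/-- Subtyping in a context, `C <: E ⊣ Ω`. -/
inductive Sub : List Feature → ClassName → ClassName → Prop
  | refl {Ω C} : Sub Ω C C
  | extend {Ω C E} : C ≠ .object → pl.ValidClass Ω C →
      (∀ Ψ L, pl.fm.Sometimes Ω Ψ → pl.ct Ψ C = some (.cls L) → pl.ValidClass (Ψ :: Ω) L.super) →
      (∀ Ψ L, pl.fm.Sometimes Ω Ψ → pl.ct Ψ C = some (.cls L) → Sub (Ψ :: Ω) L.super E) →
      Sub Ω C E

/-- Field lookup `fields(Ω, q) = R`; the inner lists of `R` are the alternatives. -/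
inductive Fields : List Feature → QType → List (List MarkedField) → Prop
  | base {Ω} : Fields Ω .baseObject [[]]
  | never {Ω Φ C R} : pl.fm.Never Ω Φ → Fields Ω (pred pl.rt Φ C) R → Fields Ω (.mk Φ C) R
  | alwaysCls {Ω Φ C L q R} : pl.fm.Always Ω Φ [Φ] → pl.ct Φ C = some (.cls L) →
      last pl.rt L.super = some q → Fields Ω q R →
      Fields Ω (.mk Φ C) (appendFields R L.fields false)
  | alwaysRef {Ω Φ C D R} : pl.fm.Always Ω Φ [Φ] → pl.ct Φ C = some (.ref D) →
      Fields Ω (pred pl.rt Φ C) R → Fields Ω (.mk Φ C) (appendFields R D.fields false)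
  | optionalCls {Ω Φ C L q R} : pl.fm.Sometimes Ω Φ → pl.fm.Always Ω Φ [] →
      pl.ct Φ C = some (.cls L) → last pl.rt L.super = some q → Fields Ω q R →
      Fields Ω (.mk Φ C) (appendFields R L.fields true)
  | optionalRef {Ω Φ C D R} : pl.fm.Sometimes Ω Φ → pl.fm.Always Ω Φ [] →
      pl.ct Φ C = some (.ref D) → Fields Ω (pred pl.rt Φ C) R →
      Fields Ω (.mk Φ C) (appendFields R D.fields true)
  | split {Ω Φ C} {G : List Feature} {R : Feature → List (List MarkedField)} :
      pl.fm.Always Ω Φ G → 2 ≤ G.length →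
      (∀ Ψ ∈ G, Fields (Ψ :: Ω) (.mk Φ C) (R Ψ)) → Fields Ω (.mk Φ C) (G.flatMap R)

/-- Method type lookup `mtype(Ω, m, q) = S`; `S` lists the possible signatures. -/
inductive Mtype (Ω : List Feature) (m : MethodName) : QType → List Sig → Prop
  | base : Mtype Ω m .baseObject []
  | hereCls {Φ C L M q S S'} : pl.fm.Sometimes Ω Φ → pl.ct Φ C = some (.cls L) →
      M ∈ L.methods → M.name = m → Mtype Ω m (pred pl.rt Φ C) S →
      last pl.rt L.super = some q → Mtype Ω m q S' → Mtype Ω m (.mk Φ C) (M.sig :: (S ++ S'))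
  | hereRef {Φ C R M S} : pl.fm.Sometimes Ω Φ → pl.ct Φ C = some (.ref R) →
      M ∈ R.methods → M.name = m → Mtype Ω m (pred pl.rt Φ C) S → Mtype Ω m (.mk Φ C) (M.sig :: S)
  | skipCls {Φ C L q S S'} : pl.fm.Sometimes Ω Φ → pl.ct Φ C = some (.cls L) →
      (∀ M ∈ L.methods, M.name ≠ m) → Mtype Ω m (pred pl.rt Φ C) S →
      last pl.rt L.super = some q → Mtype Ω m q S' → Mtype Ω m (.mk Φ C) (S ++ S')
  | skipRef {Φ C R S} : pl.fm.Sometimes Ω Φ → pl.ct Φ C = some (.ref R) →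
      (∀ M ∈ R.methods, M.name ≠ m) → Mtype Ω m (pred pl.rt Φ C) S → Mtype Ω m (.mk Φ C) S
  | never {Φ C S} : pl.fm.Never Ω Φ → Mtype Ω m (pred pl.rt Φ C) S → Mtype Ω m (.mk Φ C) S

/-- No other feature that may be present together with `Ω` introduces the class `C`. -/
def IntroduceClass (Ω : List Feature) (Φ : Feature) (C : ClassName) : Prop :=
  ∀ Ψ, Ψ ≠ Φ → pl.fm.Sometimes Ω Ψ → ¬ ∃ L, pl.ct Ψ C = some (.cls L)

def IntroduceField (Ω : List Feature) (f : FieldName) (q : QType) : Prop :=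
  ∃ R, pl.Fields Ω q R ∧ ∀ l ∈ R, ∀ F ∈ l, F.1.name ≠ f

def IntroduceMethod (Ω : List Feature) (m : MethodName) (q : QType) : Prop :=
  pl.Mtype Ω m q []

/-- A declaration of `C` is always reachable among the features that precede `Φ`. -/
def Refine (Ω : List Feature) (Φ : Feature) (C : ClassName) : Prop :=
  pl.ValidClassIn Ω (before pl.rt Φ C) C

/-- `m` is always reachable in class `C` by way of the features `Ψs`, and every signature of `m`
found from `q` on is `σ`. -/
def Override (Ω Ψs : List Feature) (C : ClassName) (m : MethodName) (q : QType) (σ : Sig) : Prop :=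
  pl.ValidMethodIn Ω Ψs C m ∧ ∃ S, pl.Mtype Ω m q S ∧ ∀ σ' ∈ S, σ' = σ

/-- Term typing `Γ ⊢ t : Cs ⊣ Ω`, with the list `Cs` of the possible types of `t` in the variants
that contain the features `Ω`. For code that belongs to a feature `Φ`, `Ω` is `[Φ]`; for the term
of the product line, which belongs to no feature, `Ω` is empty. -/
inductive HasType (stupid : Bool) (Γ : Ctx) (Ω : List Feature) : Term → List ClassName → Prop
  | var {x C} : (x, C) ∈ Γ → HasType stupid Γ Ω (.var x) [C]
  | field {t₀ Es f} {R : ClassName → List (List MarkedField)} : HasType stupid Γ Ω t₀ Es →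
      (∀ E ∈ Es, pl.ValidField Ω E f) →
      (∀ E ∈ Es, ∃ q, last pl.rt E = some q ∧ pl.Fields Ω q (R E)) →
      (∀ E ∈ Es, ∀ l ∈ R E, ∃ F ∈ l, F.1.name = f) →
      HasType stupid Γ Ω (.field t₀ f)
        (Es.flatMap fun E => (R E).flatMap fun l =>
          (l.filter fun F => F.1.name = f).map fun F => F.1.ty)
  | invk {t₀ Es m} {S : ClassName → List Sig} {ts : List Term} {Css : List (List ClassName)} :
      HasType stupid Γ Ω t₀ Es → (∀ E ∈ Es, pl.ValidMethod Ω E m) →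
      (∀ E ∈ Es, ∃ q, last pl.rt E = some q ∧ pl.Mtype Ω m q (S E)) →
      ts.length = Css.length → (∀ p ∈ ts.zip Css, HasType stupid Γ Ω p.1 p.2) →
      (∀ E ∈ Es, ∀ σ ∈ S E, Css.length = σ.params.length ∧
        ∀ p ∈ Css.zip σ.params, ∀ C ∈ p.1, pl.Sub Ω C p.2) →
      HasType stupid Γ Ω (.invk t₀ m ts) (Es.flatMap fun E => (S E).map Sig.ret)
  | new {C q R} {ts : List Term} {Css : List (List ClassName)} : pl.ValidClass Ω C →
      last pl.rt C = some q → pl.Fields Ω q R →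
      ts.length = Css.length → (∀ p ∈ ts.zip Css, HasType stupid Γ Ω p.1 p.2) →
      (∀ l ∈ R, (∀ F ∈ l, F.2 = false) ∧ Css.length = l.length ∧
        ∀ p ∈ Css.zip l, ∀ B ∈ p.1, pl.Sub Ω B p.2.1.ty) →
      HasType stupid Γ Ω (.new C ts) [C]
  | udcast {t₀ Es C} : HasType stupid Γ Ω t₀ Es → pl.ValidClass Ω C →
      (∀ E ∈ Es, pl.Sub Ω E C ∨ pl.Sub Ω C E) → HasType stupid Γ Ω (.cast C t₀) [C]
  | scast {t₀ Es C} : stupid = true → HasType stupid Γ Ω t₀ Es → pl.ValidClass Ω C →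
      (∃ E ∈ Es, ¬ pl.Sub Ω E C ∧ ¬ pl.Sub Ω C E) → HasType stupid Γ Ω (.cast C t₀) [C]

/-- All possible types of the body of `M` are subtypes of the declared result type, and the
parameter and result types are always reachable. -/
def BodyOK (stupid : Bool) (Φ : Feature) (C : ClassName) (M : MethodDecl) : Prop :=
  (∃ Es, pl.HasType stupid (M.ctx C) [Φ] M.body Es ∧ ∀ E ∈ Es, pl.Sub [Φ] E M.ret) ∧
    (∀ B ∈ M.sig.params, pl.ValidClass [Φ] B) ∧ pl.ValidClass [Φ] M.ret

/-- Well-formedness of methods, `M OK ⊣ Φ.C`. -/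
inductive MethodOK (stupid : Bool) (Φ : Feature) (C : ClassName) (M : MethodDecl) : Prop
  | clsIntro {L q} : pl.BodyOK stupid Φ C M → pl.ct Φ C = some (.cls L) → M.overrides = false →
      last pl.rt L.super = some q → pl.IntroduceMethod [Φ] M.name q → MethodOK stupid Φ C M
  | clsOverride {L q} : pl.BodyOK stupid Φ C M → pl.ct Φ C = some (.cls L) → M.overrides = true →
      last pl.rt L.super = some q →
      pl.Override [Φ] (pl.rt L.super) L.super M.name q M.sig → MethodOK stupid Φ C M
  | refIntro {R} : pl.BodyOK stupid Φ C M → pl.ct Φ C = some (.ref R) → M.overrides = false →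
      pl.IntroduceMethod [Φ] M.name (pred pl.rt Φ C) → MethodOK stupid Φ C M
  | refOverride {R} : pl.BodyOK stupid Φ C M → pl.ct Φ C = some (.ref R) → M.overrides = true →
      pl.Override [Φ] (before pl.rt Φ C) C M.name (pred pl.rt Φ C) M.sig → MethodOK stupid Φ C M

/-- `L OK ⊣ Φ` -/
structure ClassOK (stupid : Bool) (Φ : Feature) (L : ClassDecl) : Prop where
  methods : ∀ M ∈ L.methods, pl.MethodOK stupid Φ L.name M
  introduce : pl.IntroduceClass [Φ] Φ L.name
  super : pl.ValidClass [Φ] L.super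
  fieldTypes : ∀ F ∈ L.fields, pl.ValidClass [Φ] F.ty
  fields : ∃ q, last pl.rt L.super = some q ∧ ∀ F ∈ L.fields, pl.IntroduceField [Φ] F.name q

/-- `R OK ⊣ Φ` -/
structure RefOK (stupid : Bool) (Φ : Feature) (R : RefDecl) : Prop where
  methods : ∀ M ∈ R.methods, pl.MethodOK stupid Φ R.name M
  refine : pl.Refine [Φ] Φ R.name
  fieldTypes : ∀ F ∈ R.fields, pl.ValidClass [Φ] F.ty
  fields : ∀ F ∈ R.fields, pl.IntroduceField [Φ] F.name (pred pl.rt Φ R.name)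

/-- The sanity conditions on the introduction table: its entries list, in the order of the feature
model, the features that introduce a class, a field or a method. -/
structure IntroTableSane : Prop where
  cls_ordered : ∀ C, (pl.it.cls C).Sublist pl.fm.features
  field_ordered : ∀ C f, (pl.it.field C f).Sublist pl.fm.features
  method_ordered : ∀ C m, (pl.it.method C m).Sublist pl.fm.features
  mem_cls : ∀ Φ C, Φ ∈ pl.it.cls C ↔ ∃ L, pl.ct Φ C = some (.cls L)
  mem_field : ∀ Φ C f, Φ ∈ pl.it.field C f ↔
    ∃ d, pl.ct Φ C = some d ∧ ∃ F ∈ d.fields, F.name = f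
  mem_method : ∀ Φ C m, Φ ∈ pl.it.method C m ↔
    ∃ d, pl.ct Φ C = some d ∧ ∃ M ∈ d.methods, M.name = m ∧ M.overrides = false

/-- The sanity conditions on the refinement table. -/
structure RefTableSane : Prop where
  ordered : ∀ C, (pl.rt C).Sublist pl.fm.features
  mem_iff : ∀ Φ C, Φ ∈ pl.rt C ↔ pl.ct Φ C ≠ none

/-- Well-typed product lines; `stupid` as for programs. Inheritance may have cycles across
alternative features, but not within the declarations of a legal combination. -/
structure WellTyped (stupid : Bool) : Prop where
  term : ∃ Cs, pl.HasType stupid [] [] pl.term Cs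
  classes : ∀ Φ C L, pl.ct Φ C = some (.cls L) → pl.ClassOK stupid Φ L
  refinements : ∀ Φ C R, pl.ct Φ C = some (.ref R) → pl.RefOK stupid Φ R
  table : TableSane pl.ct
  acyclic : ∀ s ∈ pl.fm.legal, Acyclic (ClassTable.select pl.ct s)
  introTable : pl.IntroTableSane
  refTable : pl.RefTableSane

end ProductLine

end FFJ

/-!
Why the theorem is true.  Fix a legal combination `s` of features.  Every judgment of the
product-line type system with context `Ω` describes all variants of `Ω`, so it specializes to a
judgment of the derived program whenever `s` is one of them.

* A lookup that starts at a qualified type `q` of the product line corresponds to the lookup in the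
  derived program that starts at `q.restrict`, the last entry of the refinement chain up to `q` that
  belongs to `s`.
* The derived `fields` is, up to absent optional fields, one of the alternatives that the
  product-line lookup computes (`ProductLine.Fields.derive`).  The delicate point is a class
  declaration in a feature that is optional and belongs to no group of alternatives: there the
  product-line lookup passes to the superclass of a declaration that may be absent from `s`.
  This cannot happen if every variant of `Ω` declares the class (`DeclaredUpTo`), because the
  features that declare it exclude each other and hence form a group of alternatives.
* The product-line `mtype` over-approximates the derived one (`ProductLine.Mtype.derive`), and
  `validref` yields that fields and methods are really found in the derived program.
* Hence one of the possible types of a term is a type of it in the derived program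
  (`ProductLine.HasType.derive`).
* The refinement chains of the derived program start with a class declaration and continue with
  refinements only: a class is declared once per variant, and before each of its refinements.
-/

namespace FFJ

/-! ### Refinement chains -/

/-- The qualified type at which the lookup in the initial segment `l` of the refinement chain of
`C` starts. -/
def lastOf (l : List Feature) (C : ClassName) : QType :=
  match l.getLast? with
  | none => .baseObject
  | some Ψ => .mk Ψ C

theorem lastOf_append_singleton (l : List Feature) (Ψ : Feature) (C : ClassName) :
    lastOf (l ++ [Ψ]) C = .mk Ψ C := by
  simp [lastOf]

theorem pred_eq_lastOf (rt : RefTable) (Φ : Feature) (C : ClassName) :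
    pred rt Φ C = lastOf (before rt Φ C) C := rfl

theorem before_prefix (rt : RefTable) (Φ : Feature) (C : ClassName) :
    before rt Φ C <+: rt C :=
  List.takeWhile_prefix _

theorem before_eq_of_prefix {rt : RefTable} {C : ClassName} (hn : (rt C).Nodup)
    {l : List Feature} {Φ : Feature} (h : l ++ [Φ] <+: rt C) : before rt Φ C = l := by
  obtain ⟨B, hB⟩ := h
  rw [← hB] at hn
  have hΦ : Φ ∉ l := fun hm => by
    have := (List.nodup_append.1 (List.nodup_append.1 hn).1).2.2 Φ hm Φ (by simp)
    exact this rfl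
  rw [before, ← hB, List.append_assoc, List.takeWhile_append_of_pos]
  · simp
  · intro a ha
    simpa using fun h' : a = Φ => hΦ (h' ▸ ha)

/-- The start of a lookup in a segment that contains `Ψ` is `Ψ` itself or a feature after it. -/
theorem exists_lastOf_eq {rt : RefTable} {C : ClassName} (hn : (rt C).Nodup) {l : List Feature}
    (hl : l <+: rt C) {Ψ : Feature} (hΨ : Ψ ∈ l) :
    ∃ Φ ∈ l, lastOf l C = .mk Φ C ∧ (Ψ = Φ ∨ Ψ ∈ before rt Φ C) ∧
      (before rt Φ C).length < l.length := by
  rcases List.eq_nil_or_concat' l with rfl | ⟨l', Φ, rfl⟩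
  · simp at hΨ
  · refine ⟨Φ, by simp, lastOf_append_singleton _ _ _, ?_, ?_⟩ <;>
      rw [before_eq_of_prefix hn hl]
    · simpa [or_comm] using hΨ
    · simp

theorem last_eq_lastOf {rt : RefTable} (hobj : rt .object = []) {C : ClassName} {q : QType}
    (h : last rt C = some q) : q = lastOf (rt C) C := by
  unfold last at h
  split_ifs at h with hC
  · subst hC
    simpa [hobj, lastOf] using h.symm
  · obtain ⟨Ψ, hΨ, rfl⟩ := Option.map_eq_some_iff.1 h
    simp [lastOf, hΨ]

theorem last_eq_some_lastOf {rt : RefTable} (hobj : rt .object = []) {C : ClassName}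
    (h : C = .object ∨ ∃ Ψ, Ψ ∈ rt C) : last rt C = some (lastOf (rt C) C) := by
  by_cases hC : C = .object
  · subst hC
    simp [last, hobj, lastOf]
  · obtain ⟨Ψ, hΨ⟩ := h.resolve_left hC
    have hs : (rt C).getLast? = some ((rt C).getLast (List.ne_nil_of_mem hΨ)) :=
      List.getLast?_eq_some_getLast _
    simp [last, hC, lastOf, hs]

/-- The start of the lookup in the derived program that corresponds to a lookup from `q` in the
product line: the last feature of `s` in the refinement chain up to `q`. -/
def QType.restrict (rt : RefTable) (s : Finset Feature) : QType → QType
  | .baseObject => .baseObject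
  | .mk Φ C => lastOf ((before rt Φ C ++ [Φ]).filter (· ∈ s)) C

theorem QType.restrict_mk_of_mem {rt : RefTable} {s : Finset Feature} {Φ : Feature}
    {C : ClassName} (h : Φ ∈ s) : (QType.mk Φ C).restrict rt s = .mk Φ C := by
  simp [QType.restrict, List.filter_append, h, lastOf_append_singleton]

theorem QType.restrict_lastOf {rt : RefTable} {s : Finset Feature} {C : ClassName}
    (hn : (rt C).Nodup) {l : List Feature} (hl : l <+: rt C) :
    (lastOf l C).restrict rt s = lastOf (l.filter (· ∈ s)) C := by
  rcases List.eq_nil_or_concat' l with rfl | ⟨l', Φ, rfl⟩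
  · rfl
  · rw [lastOf_append_singleton, QType.restrict, before_eq_of_prefix hn hl]

theorem QType.restrict_mk_of_notMem {rt : RefTable} {s : Finset Feature} {Φ : Feature}
    {C : ClassName} (hn : (rt C).Nodup) (h : Φ ∉ s) :
    (QType.mk Φ C).restrict rt s = (pred rt Φ C).restrict rt s := by
  rw [pred_eq_lastOf, QType.restrict_lastOf hn (before_prefix _ _ _)]
  simp [QType.restrict, List.filter_append, h]

/-! ### Lookups along the chain of an FFJ program -/

namespace Program

variable {P : Program}

theorem RefTableSane.nodup (h : P.RefTableSane) (C : ClassName) : (P.rt C).Nodup := by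
  obtain ⟨order, ho, hs⟩ := h.ordered
  exact (hs C).nodup ho

theorem RefTableSane.exists_ref (h : P.RefTableSane) {Φ Ψ : Feature} {C : ClassName}
    (hΦ : Φ ∈ P.rt C) (hΨ : Ψ ∈ before P.rt Φ C) : ∃ R, P.ct Φ C = some (.ref R) := by
  cases hl : P.rt C with
  | nil => simp [hl] at hΦ
  | cons Φ₀ l =>
    have hne : Φ ≠ Φ₀ := by
      rintro rfl
      simp [before, hl] at hΨ
    rw [hl] at hΦ
    exact (h.shape _ _ _ hl).2 _ ((List.mem_cons.1 hΦ).resolve_left hne)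

/-- The fields found from a predecessor in the refinement chain are found later in the chain. -/
theorem Fields.exists_of_mem_before (h : P.RefTableSane) {q : QType} {gs : List FieldDecl}
    (hF : P.Fields q gs) : ∀ {Φ Ψ : Feature} {C : ClassName}, q = .mk Φ C → Φ ∈ P.rt C →
      Ψ ∈ before P.rt Φ C → ∃ gs', P.Fields (.mk Ψ C) gs' ∧ gs' ⊆ gs := by
  induction hF with
  | base => rintro _ _ _ ⟨⟩
  | cls hct _ _ _ =>
    rintro _ _ _ ⟨⟩ hΦ hΨ
    obtain ⟨R, hR⟩ := h.exists_ref hΦ hΨ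
    simp [hct] at hR
  | @ref Φ C R gs hct hF ih =>
    rintro _ Ψ _ ⟨⟩ hΦ hΨ
    obtain ⟨X, hX, hlast, hΨX, -⟩ := exists_lastOf_eq (h.nodup C) (before_prefix P.rt Φ C) hΨ
    rw [← pred_eq_lastOf] at hlast
    rcases hΨX with rfl | hΨX
    · exact ⟨gs, hlast ▸ hF, by simp⟩
    · obtain ⟨gs', h1, h2⟩ := ih hlast ((before_prefix _ _ _).subset hX) hΨX
      exact ⟨gs', h1, fun _ hx => List.mem_append_left _ (h2 hx)⟩

theorem Mtype.exists_of_mem_before (h : P.RefTableSane) {m : MethodName} {Ψ : Feature}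
    {C : ClassName} (hm : ∃ σ, P.Mtype m (.mk Ψ C) σ) (n : ℕ) :
    ∀ {Φ : Feature}, (before P.rt Φ C).length = n → Φ ∈ P.rt C → Ψ ∈ before P.rt Φ C →
      ∃ σ, P.Mtype m (.mk Φ C) σ := by
  induction n using Nat.strong_induction_on with
  | _ n ih =>
    intro Φ hn hΦ hΨ
    obtain ⟨R, hR⟩ := h.exists_ref hΦ hΨ
    by_cases hex : ∃ M ∈ R.methods, M.name = m
    · obtain ⟨M, hM, hname⟩ := hex
      exact ⟨_, .here hR hM hname⟩
    · push Not at hex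
      obtain ⟨X, hX, hlast, hΨX, hlt⟩ :=
        exists_lastOf_eq (h.nodup C) (before_prefix P.rt Φ C) hΨ
      rw [← pred_eq_lastOf] at hlast
      have : ∃ σ, P.Mtype m (.mk X C) σ := by
        rcases hΨX with rfl | hΨX
        · exact hm
        · exact ih _ (hn ▸ hlt) rfl ((before_prefix _ _ _).subset hX) hΨX
      obtain ⟨σ, hσ⟩ := this
      exact ⟨σ, .ref hR hex (hlast ▸ hσ)⟩

theorem Mtype.exists_lastOf (h : P.RefTableSane) {m : MethodName} {Ψ : Feature}
    {C : ClassName} {l : List Feature} (hl : l <+: P.rt C) (hΨ : Ψ ∈ l)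
    (hm : ∃ σ, P.Mtype m (.mk Ψ C) σ) : ∃ σ, P.Mtype m (lastOf l C) σ := by
  obtain ⟨X, hX, hlast, hΨX, -⟩ := exists_lastOf_eq (h.nodup C) hl hΨ
  rw [hlast]
  rcases hΨX with rfl | hΨX
  · exact hm
  · exact Mtype.exists_of_mem_before h hm _ rfl (hl.subset hX) hΨX

theorem Fields.exists_lastOf (h : P.RefTableSane) {Ψ : Feature} {C : ClassName}
    {l : List Feature} {gs : List FieldDecl} (hl : l <+: P.rt C) (hΨ : Ψ ∈ l)
    (hF : P.Fields (lastOf l C) gs) : ∃ gs', P.Fields (.mk Ψ C) gs' ∧ gs' ⊆ gs := by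
  obtain ⟨X, hX, hlast, hΨX, -⟩ := exists_lastOf_eq (h.nodup C) hl hΨ
  rw [hlast] at hF
  rcases hΨX with rfl | hΨX
  · exact ⟨gs, hF, by simp⟩
  · exact hF.exists_of_mem_before h rfl (hl.subset hX) hΨX

end Program

namespace ProductLine

variable {pl : ProductLine} {stupid : Bool} {fs : List Feature} {Ω : List Feature}

/-! ### The tables of the derived program -/

theorem derive_ct_eq_some {Φ : Feature} {C : ClassName} {d : Decl} :
    (pl.derive fs).ct Φ C = some d ↔ Φ ∈ fs.toFinset ∧ pl.ct Φ C = some d := by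
  simp only [derive, ClassTable.select]
  split_ifs with h <;> simp [h]

theorem derive_rt (C : ClassName) :
    (pl.derive fs).rt C = (pl.rt C).filter (· ∈ fs.toFinset) := rfl

theorem mem_derive_rt {Φ : Feature} {C : ClassName} :
    Φ ∈ (pl.derive fs).rt C ↔ Φ ∈ pl.rt C ∧ Φ ∈ fs.toFinset := by
  simp [derive_rt]

theorem before_derive {Φ : Feature} (hΦ : Φ ∈ fs.toFinset) (C : ClassName) :
    before (pl.derive fs).rt Φ C = (before pl.rt Φ C).filter (· ∈ fs.toFinset) := by
  simp only [before, derive_rt]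
  induction pl.rt C with
  | nil => rfl
  | cons a l ih =>
    by_cases ha : a = Φ
    · subst ha
      rw [List.filter_cons_of_pos (by simpa using hΦ)]
      simp
    · by_cases has : a ∈ fs.toFinset <;>
        simp only [List.filter_cons, List.takeWhile_cons, ha, has, decide_true, decide_false,
          ne_eq, not_false_eq_true, if_true, Bool.false_eq_true, if_false, ih]

namespace WellTyped

theorem nodup_rt (hpl : pl.WellTyped stupid) (C : ClassName) : (pl.rt C).Nodup :=
  (hpl.refTable.ordered C).nodup pl.fm.nodup

theorem rt_object (hpl : pl.WellTyped stupid) : pl.rt .object = [] := by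
  refine List.eq_nil_iff_forall_not_mem.2 fun Φ h => ?_
  exact (hpl.refTable.mem_iff Φ .object).1 h (hpl.table.object_undeclared Φ)

theorem derive_rt_object (hpl : pl.WellTyped stupid) : (pl.derive fs).rt .object = [] := by
  simp [derive_rt, hpl.rt_object]

theorem mem_rt (hpl : pl.WellTyped stupid) {Φ : Feature} {C : ClassName} {d : Decl}
    (h : pl.ct Φ C = some d) : Φ ∈ pl.rt C :=
  (hpl.refTable.mem_iff Φ C).2 (by simp [h])

theorem ne_object (hpl : pl.WellTyped stupid) {Φ : Feature} {C : ClassName} {d : Decl}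
    (h : pl.ct Φ C = some d) : C ≠ .object := by
  rintro rfl
  simp [hpl.table.object_undeclared] at h

theorem pred_derive (hpl : pl.WellTyped stupid) {Φ : Feature} (hΦ : Φ ∈ fs.toFinset)
    (C : ClassName) :
    pred (pl.derive fs).rt Φ C = (pred pl.rt Φ C).restrict pl.rt fs.toFinset := by
  rw [pred_eq_lastOf, pred_eq_lastOf, before_derive hΦ,
    QType.restrict_lastOf (hpl.nodup_rt C) (before_prefix _ _ _)]

theorem restrict_last (hpl : pl.WellTyped stupid) {C : ClassName} {q : QType}
    (h : last pl.rt C = some q) :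
    q.restrict pl.rt fs.toFinset = lastOf ((pl.derive fs).rt C) C := by
  rw [last_eq_lastOf hpl.rt_object h, QType.restrict_lastOf (hpl.nodup_rt C) List.prefix_rfl,
    derive_rt]

/-- In every legal combination, at most one feature declares a given class. -/
theorem cls_unique (hpl : pl.WellTyped stupid) {s : Finset Feature} (hs : s ∈ pl.fm.legal)
    {Φ Ψ : Feature} {C : ClassName} {L L' : ClassDecl} (hΦ : Φ ∈ s) (hΨ : Ψ ∈ s)
    (h : pl.ct Φ C = some (.cls L)) (h' : pl.ct Ψ C = some (.cls L')) : Ψ = Φ := by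
  by_contra hne
  have hname : L.name = C := hpl.table.name_eq _ _ _ h
  exact (hpl.classes _ _ _ h).introduce Ψ hne ⟨s, ⟨hs, by simpa using hΦ⟩, hΨ⟩
    ⟨L', hname ▸ h'⟩

/-- In every legal combination, a refinement of a class comes after a declaration of it. -/
theorem exists_cls_before (hpl : pl.WellTyped stupid) {s : Finset Feature} (hs : s ∈ pl.fm.legal)
    {Φ : Feature} {C : ClassName} {R : RefDecl} (hΦ : Φ ∈ s) (h : pl.ct Φ C = some (.ref R)) :
    ∃ Ψ ∈ before pl.rt Φ C, Ψ ∈ s ∧ ∃ L, pl.ct Ψ C = some (.cls L) := by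
  have hname : R.name = C := hpl.table.name_eq _ _ _ h
  have hr := (hpl.refinements _ _ _ h).refine
  rw [hname] at hr
  obtain ⟨Ψ, h1, h2, h3⟩ :=
    hr.resolve_left (hpl.ne_object h) s ⟨hs, by simpa using hΦ⟩
  exact ⟨Ψ, h1, h2, (hpl.introTable.mem_cls _ _).1 h3⟩

theorem exists_cls (hpl : pl.WellTyped stupid) {s : Finset Feature} (hs : s ∈ pl.fm.legal)
    {Φ : Feature} {C : ClassName} {d : Decl} (hΦ : Φ ∈ s) (h : pl.ct Φ C = some d) :
    ∃ Ψ ∈ s, ∃ L, pl.ct Ψ C = some (.cls L) := by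
  cases d with
  | cls L => exact ⟨Φ, hΦ, L, h⟩
  | ref R =>
    obtain ⟨Ψ, -, h2, h3⟩ := hpl.exists_cls_before hs hΦ h
    exact ⟨Ψ, h2, h3⟩

theorem refTableSane_derive (hpl : pl.WellTyped stupid) (hfs : pl.fm.Valid fs) :
    (pl.derive fs).RefTableSane where
  mem_iff Φ C := by
    rw [mem_derive_rt, hpl.refTable.mem_iff]
    simp only [derive, ClassTable.select]
    split_ifs with h <;> simp [h]
  ordered := ⟨pl.fm.features, pl.fm.nodup, fun C =>
    List.filter_sublist.trans (hpl.refTable.ordered C)⟩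
  shape C Φ Ψs hrt := by
    have hn : (Φ :: Ψs).Nodup := hrt ▸ (hpl.nodup_rt C).filter _
    have key : ∀ Ψ ∈ Φ :: Ψs, Ψ ∈ fs.toFinset ∧ ∃ d, pl.ct Ψ C = some d := by
      intro Ψ hΨ
      rw [← hrt, mem_derive_rt, hpl.refTable.mem_iff] at hΨ
      exact ⟨hΨ.2, Option.ne_none_iff_exists'.1 hΨ.1⟩
    have hhead : ∃ L, pl.ct Φ C = some (.cls L) := by
      obtain ⟨hΦ, d, hd⟩ := key Φ (by simp)
      cases d with
      | cls L => exact ⟨L, hd⟩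
      | ref R =>
        obtain ⟨Ψ, h1, h2, -⟩ := hpl.exists_cls_before hfs hΦ hd
        have : Ψ ∈ before (pl.derive fs).rt Φ C := by
          rw [before_derive hΦ]
          simpa using ⟨h1, by simpa using h2⟩
        simp [before, hrt] at this
    obtain ⟨L, hL⟩ := hhead
    have hΦ := (key Φ (by simp)).1
    refine ⟨⟨L, derive_ct_eq_some.2 ⟨hΦ, hL⟩⟩, fun Ψ hΨ => ?_⟩
    obtain ⟨hΨs, d, hd⟩ := key Ψ (by simp [hΨ])
    cases d with
    | ref R => exact ⟨R, derive_ct_eq_some.2 ⟨hΨs, hd⟩⟩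
    | cls L' =>
      have := hpl.cls_unique hfs hΦ hΨs hL hd
      subst this
      simp [hΨ] at hn

end WellTyped

/-! ### References that are valid in all variants -/

theorem ValidClass.exists_cls (hpl : pl.WellTyped stupid) {C : ClassName}
    (h : pl.ValidClass Ω C) (hv : pl.fm.Variant Ω fs.toFinset) :
    C = .object ∨ ∃ Ψ ∈ fs.toFinset, ∃ L, pl.ct Ψ C = some (.cls L) :=
  h.imp_right fun h => by
    obtain ⟨Ψ, h1, h2, -⟩ := h _ hv
    exact ⟨Ψ, h2, (hpl.introTable.mem_cls _ _).1 h1⟩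

theorem ValidClass.last_derive (hpl : pl.WellTyped stupid) {C : ClassName}
    (h : pl.ValidClass Ω C) (hv : pl.fm.Variant Ω fs.toFinset) :
    last (pl.derive fs).rt C = some (lastOf ((pl.derive fs).rt C) C) := by
  refine last_eq_some_lastOf hpl.derive_rt_object ?_
  refine (h.exists_cls hpl hv).imp_right ?_
  rintro ⟨Ψ, hΨ, L, hL⟩
  exact ⟨Ψ, mem_derive_rt.2 ⟨hpl.mem_rt hL, hΨ⟩⟩

theorem ValidClass.of_forall_exists_decl (hpl : pl.WellTyped stupid) {C : ClassName}
    (h : ∀ s, pl.fm.Variant Ω s → ∃ Ψ ∈ s, ∃ d, pl.ct Ψ C = some d) : pl.ValidClass Ω C := by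
  refine .inr fun s hs => ?_
  obtain ⟨Φ, hΦ, d, hd⟩ := h s hs
  obtain ⟨Ψ, hΨ, hL⟩ := hpl.exists_cls hs.1 hΦ hd
  have := (hpl.introTable.mem_cls Ψ C).2 hL
  exact ⟨Ψ, this, hΨ, this⟩

theorem ValidField.validClass (hpl : pl.WellTyped stupid) {C : ClassName} {f : FieldName}
    (h : pl.ValidField Ω C f) : pl.ValidClass Ω C := by
  refine .of_forall_exists_decl hpl fun s hs => ?_
  cases h s hs with
  | own _ h2 h3 =>
    obtain ⟨d, hd, -⟩ := (hpl.introTable.mem_field _ _ _).1 h3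
    exact ⟨_, h2, d, hd⟩
  | inherited _ h2 h3 _ => exact ⟨_, h2, _, h3⟩

theorem ValidMethod.validClass (hpl : pl.WellTyped stupid) {C : ClassName} {m : MethodName}
    (h : pl.ValidMethod Ω C m) : pl.ValidClass Ω C := by
  refine .of_forall_exists_decl hpl fun s hs => ?_
  cases h s hs with
  | own _ h2 h3 =>
    obtain ⟨d, hd, -⟩ := (hpl.introTable.mem_method _ _ _).1 h3
    exact ⟨_, h2, d, hd⟩
  | inherited _ h2 h3 _ => exact ⟨_, h2, _, h3⟩

theorem WellTyped.last_super_derive (hpl : pl.WellTyped stupid) (hfs : pl.fm.Valid fs)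
    {Φ : Feature} {C : ClassName} {L : ClassDecl} (hΦ : Φ ∈ fs.toFinset)
    (h : pl.ct Φ C = some (.cls L)) :
    last (pl.derive fs).rt L.super = some (lastOf ((pl.derive fs).rt L.super) L.super) :=
  (hpl.classes _ _ _ h).super.last_derive hpl ⟨hfs, by simpa using hΦ⟩

/-- A method that is present in the variant is found by the lookup in the derived program. -/
theorem MethodPresent.exists_mtype (hpl : pl.WellTyped stupid) (hfs : pl.fm.Valid fs)
    {m : MethodName} {Ψs : List Feature} {C : ClassName}
    (h : pl.MethodPresent fs.toFinset m Ψs C) (hΨs : Ψs <+: pl.rt C) :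
    ∃ σ, (pl.derive fs).Mtype m (lastOf (Ψs.filter (· ∈ fs.toFinset)) C) σ := by
  have hsane := hpl.refTableSane_derive hfs
  induction h with
  | own h1 h2 h3 =>
    obtain ⟨d, hd, M, hM, hname, -⟩ := (hpl.introTable.mem_method _ _ _).1 h3
    exact Program.Mtype.exists_lastOf hsane (hΨs.filter _)
      (List.mem_filter.2 ⟨h1, by simpa using h2⟩)
      ⟨_, .here (derive_ct_eq_some.2 ⟨h2, hd⟩) hM hname⟩
  | @inherited Ψs C Ψ L h1 h2 h3 _ ih =>
    refine Program.Mtype.exists_lastOf hsane (hΨs.filter _)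
      (List.mem_filter.2 ⟨h1, by simpa using h2⟩) ?_
    by_cases hex : ∃ M ∈ L.methods, M.name = m
    · obtain ⟨M, hM, hname⟩ := hex
      exact ⟨_, .here (derive_ct_eq_some.2 ⟨h2, h3⟩) hM hname⟩
    · push Not at hex
      obtain ⟨σ, hσ⟩ := ih List.prefix_rfl
      exact ⟨σ, .cls (derive_ct_eq_some.2 ⟨h2, h3⟩) hex (hpl.last_super_derive hfs h2 h3) hσ⟩

/-- A field that is present in the variant is among the fields found in the derived program. -/
theorem FieldPresent.mem_fields (hpl : pl.WellTyped stupid) (hfs : pl.fm.Valid fs)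
    {f : FieldName} {Ψs : List Feature} {C : ClassName}
    (h : pl.FieldPresent fs.toFinset f Ψs C) : ∀ {gs : List FieldDecl}, Ψs <+: pl.rt C →
    (pl.derive fs).Fields (lastOf (Ψs.filter (· ∈ fs.toFinset)) C) gs →
    ∃ F ∈ gs, F.name = f := by
  have hsane := hpl.refTableSane_derive hfs
  induction h with
  | own h1 h2 h3 =>
    intro gs hΨs hgs
    obtain ⟨d, hd, F, hF, hname⟩ := (hpl.introTable.mem_field _ _ _).1 h3
    obtain ⟨gs', hgs', hsub⟩ := Program.Fields.exists_lastOf hsane (hΨs.filter _)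
      (List.mem_filter.2 ⟨h1, by simpa using h2⟩) hgs
    refine ⟨F, hsub ?_, hname⟩
    cases hgs' with
    | cls hct _ _ | ref hct _ =>
      obtain rfl := Option.some.inj (hd.symm.trans (derive_ct_eq_some.1 hct).2)
      exact List.mem_append_right _ hF
  | @inherited Ψs C Ψ L h1 h2 h3 _ ih =>
    intro gs hΨs hgs
    obtain ⟨gs', hgs', hsub⟩ := Program.Fields.exists_lastOf hsane (hΨs.filter _)
      (List.mem_filter.2 ⟨h1, by simpa using h2⟩) hgs
    cases hgs' with
    | cls hct hlast hF =>
      cases Option.some.inj (h3.symm.trans (derive_ct_eq_some.1 hct).2)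
      rw [hpl.last_super_derive hfs h2 h3] at hlast
      cases hlast
      obtain ⟨F, hFm, hname⟩ := ih List.prefix_rfl hF
      exact ⟨F, hsub (List.mem_append_left _ hFm), hname⟩
    | ref hct _ => cases Option.some.inj (h3.symm.trans (derive_ct_eq_some.1 hct).2)

/-! ### Subtyping and lookups in the derived program -/

theorem Sub.derive (hpl : pl.WellTyped stupid) {C E : ClassName} (h : pl.Sub Ω C E)
    (hv : pl.fm.Variant Ω fs.toFinset) : (pl.derive fs).Sub C E := by
  induction h with
  | refl => exact .refl _
  | extend hne hC _ _ ih =>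
    obtain ⟨Ψ, hΨ, L, hL⟩ := (hC.exists_cls hpl hv).resolve_left hne
    exact .trans (.extend (derive_ct_eq_some.2 ⟨hΨ, hL⟩))
      (ih Ψ L ⟨_, hv, hΨ⟩ hL ⟨hv.1, by simpa using ⟨by simpa using hΨ, by simpa using hv.2⟩⟩)

/-- In every variant of `Ω`, a present feature of the refinement chain up to `q` declares the class
of `q`. -/
def DeclaredUpTo (pl : ProductLine) (Ω : List Feature) : QType → Prop
  | .baseObject => True
  | .mk Φ C => ∀ s, pl.fm.Variant Ω s →
      ∃ Ψ ∈ before pl.rt Φ C ++ [Φ], Ψ ∈ s ∧ ∃ L, pl.ct Ψ C = some (.cls L)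

theorem DeclaredUpTo.mono {q : QType} (h : pl.DeclaredUpTo Ω q) {Ω' : List Feature}
    (hΩ : ∀ s, pl.fm.Variant Ω' s → pl.fm.Variant Ω s) : pl.DeclaredUpTo Ω' q := by
  cases q with
  | baseObject => trivial
  | mk Φ C => exact fun s hs => h s (hΩ s hs)

theorem declaredUpTo_lastOf (hpl : pl.WellTyped stupid) {C : ClassName} {l : List Feature}
    (hl : l <+: pl.rt C)
    (h : ∀ s, pl.fm.Variant Ω s → ∃ Ψ ∈ l, Ψ ∈ s ∧ ∃ L, pl.ct Ψ C = some (.cls L)) :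
    pl.DeclaredUpTo Ω (lastOf l C) := by
  rcases List.eq_nil_or_concat' l with rfl | ⟨l', Φ, rfl⟩
  · trivial
  · rw [lastOf_append_singleton, DeclaredUpTo, before_eq_of_prefix (hpl.nodup_rt C) hl]
    exact h

theorem ValidClass.declaredUpTo (hpl : pl.WellTyped stupid) {C : ClassName}
    (h : pl.ValidClass Ω C) {q : QType} (hq : last pl.rt C = some q) :
    pl.DeclaredUpTo Ω q := by
  rw [last_eq_lastOf hpl.rt_object hq]
  rcases h with rfl | h
  · rw [hpl.rt_object]
    trivial
  · refine declaredUpTo_lastOf hpl List.prefix_rfl fun s hs => ?_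
    obtain ⟨Ψ, h1, h2, -⟩ := h s hs
    obtain ⟨L, hL⟩ := (hpl.introTable.mem_cls _ _).1 h1
    exact ⟨Ψ, hpl.mem_rt hL, h2, L, hL⟩

theorem DeclaredUpTo.pred (hpl : pl.WellTyped stupid) {Φ : Feature} {C : ClassName}
    (h : pl.DeclaredUpTo Ω (.mk Φ C))
    (hΦ : ∀ s, pl.fm.Variant Ω s → Φ ∈ s → ∀ L, pl.ct Φ C ≠ some (.cls L)) :
    pl.DeclaredUpTo Ω (pred pl.rt Φ C) := by
  refine declaredUpTo_lastOf hpl (before_prefix _ _ _) fun s hs => ?_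
  obtain ⟨Ψ, h1, h2, L, hL⟩ := h s hs
  refine ⟨Ψ, ?_, h2, L, hL⟩
  rcases List.mem_append.1 h1 with h1 | h1
  · exact h1
  · obtain rfl := List.mem_singleton.1 h1
    exact absurd hL (hΦ s hs h2 L)

/-- If every variant of `Ω` declares `C`, a feature that declares `C` in some but not all of them
belongs to a group of alternatives: the features that may declare `C`. -/
theorem DeclaredUpTo.exists_alternatives (hpl : pl.WellTyped stupid) {Φ : Feature} {C : ClassName}
    {L : ClassDecl} (h : pl.DeclaredUpTo Ω (.mk Φ C)) (hct : pl.ct Φ C = some (.cls L))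
    (hsome : pl.fm.Sometimes Ω Φ) (hnot : ¬ pl.fm.Mandatory Ω Φ) :
    ∃ G, pl.fm.Alternatives Ω G ∧ Φ ∈ G := by
  classical
  let p : Feature → Prop := fun Ψ => pl.fm.Sometimes Ω Ψ ∧ ∃ L, pl.ct Ψ C = some (.cls L)
  have hmem : ∀ Ψ, Ψ ∈ (pl.rt C).filter (fun Ψ => decide (p Ψ)) ↔ p Ψ := fun Ψ => by
    simp only [List.mem_filter, decide_eq_true_eq, and_iff_right_iff_imp]
    rintro ⟨-, L, hL⟩
    exact hpl.mem_rt hL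
  refine ⟨(pl.rt C).filter (fun Ψ => decide (p Ψ)), ⟨(hpl.nodup_rt C).filter _, ?_, ?_, ?_⟩,
    (hmem Φ).2 ⟨hsome, L, hct⟩⟩
  · intro Ψ hΨ
    obtain ⟨hΨs, L', hL'⟩ := (hmem Ψ).1 hΨ
    refine ⟨hΨs, fun hmand => ?_⟩
    -- A mandatory declaring feature is present together with `Φ` and so equals it.
    obtain ⟨s, hs, hΦs⟩ := hsome
    obtain rfl := hpl.cls_unique hs.1 hΦs (hmand s hs) hct hL'
    exact hnot hmand
  · intro Ψ hΨ Ψ' hΨ' hne s hs hmem'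
    obtain ⟨-, L', hL'⟩ := (hmem Ψ).1 hΨ
    obtain ⟨-, L'', hL''⟩ := (hmem Ψ').1 hΨ'
    exact hne (hpl.cls_unique hs.1 (hs.2 Ψ (by simp)) hmem' hL' hL'').symm
  · intro s hs
    obtain ⟨Ψ, -, hΨ, hL⟩ := h s hs
    exact ⟨Ψ, (hmem Ψ).2 ⟨⟨s, hs, hΨ⟩, hL⟩, hΨ⟩

theorem _root_.FFJ.FeatureModel.Always.mandatory {fm : FeatureModel} {Φ : Feature}
    (h : fm.Always Ω Φ [Φ]) : fm.Mandatory Ω Φ := by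
  cases h with
  | alone h => exact h
  | group h _ =>
    intro s hs
    obtain ⟨Ψ, hΨ, hΨs⟩ := h.exhaustive s hs
    exact List.mem_singleton.1 hΨ ▸ hΨs

theorem variant_cons {s : Finset Feature} {Ψ : Feature} :
    pl.fm.Variant (Ψ :: Ω) s ↔ Ψ ∈ s ∧ pl.fm.Variant Ω s := by
  simp only [FeatureModel.Variant, List.forall_mem_cons]
  tauto

/-- The fields of the derived program are those of one of the alternatives, except that fields
with the marker `@` may be missing. -/
theorem Fields.derive (hpl : pl.WellTyped stupid) {q : QType} {R : List (List MarkedField)}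
    (h : pl.Fields Ω q R) (hv : pl.fm.Variant Ω fs.toFinset) (hd : pl.DeclaredUpTo Ω q) :
    ∃ l ∈ R, ∃ gs, (pl.derive fs).Fields (q.restrict pl.rt fs.toFinset) gs ∧
      gs.Sublist (l.map Prod.fst) ∧ ((∀ F ∈ l, F.2 = false) → gs = l.map Prod.fst) := by
  have happend : ∀ {l : List MarkedField} {gs hs : List FieldDecl} (b : Bool),
      gs.Sublist (l.map Prod.fst) ∧ ((∀ F ∈ l, F.2 = false) → gs = l.map Prod.fst) →
      (gs ++ hs).Sublist ((l ++ hs.map fun F => (F, b)).map Prod.fst) ∧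
      ((∀ F ∈ l ++ hs.map (fun F => (F, b)), F.2 = false) →
        gs ++ hs = (l ++ hs.map fun F => (F, b)).map Prod.fst) := by
    intro l gs hs b ⟨h1, h2⟩
    have heq : (l ++ hs.map fun F => (F, b)).map Prod.fst = l.map Prod.fst ++ hs := by
      simp [Function.comp_def]
    rw [heq]
    refine ⟨h1.append_right hs, fun h => ?_⟩
    rw [← h2 fun F hF => h F (List.mem_append_left _ hF)]
  induction h with
  | base => exact ⟨[], by simp, [], .base, by simp, by simp⟩
  | @never Ω Φ C R hn _ ih =>
    rw [QType.restrict_mk_of_notMem (hpl.nodup_rt C) (hn _ hv)]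
    exact ih hv (hd.pred hpl fun s hs hΦ => absurd hΦ (hn s hs))
  | @alwaysCls Ω Φ C L q R ha hct hlast _ ih =>
    have hΦ := ha.mandatory _ hv
    have hsuper : pl.ValidClass Ω L.super := by
      refine (hpl.classes _ _ _ hct).super.imp_right fun h s hs => h s ⟨hs.1, ?_⟩
      simpa using ha.mandatory s hs
    obtain ⟨l, hl, gs, hgs, hsub⟩ := ih hv (hsuper.declaredUpTo hpl hlast)
    rw [QType.restrict_mk_of_mem hΦ]
    rw [hpl.restrict_last hlast] at hgs
    exact ⟨_, List.mem_map.2 ⟨l, hl, rfl⟩, _, .cls (derive_ct_eq_some.2 ⟨hΦ, hct⟩)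
      (hpl.last_super_derive hv.1 hΦ hct) hgs, happend _ hsub⟩
  | @alwaysRef Ω Φ C D R ha hct _ ih =>
    have hΦ := ha.mandatory _ hv
    obtain ⟨l, hl, gs, hgs, hsub⟩ := ih hv (hd.pred hpl fun s hs _ L => by simp [hct])
    rw [QType.restrict_mk_of_mem hΦ]
    rw [← hpl.pred_derive hΦ] at hgs
    exact ⟨_, List.mem_map.2 ⟨l, hl, rfl⟩, _, .ref (derive_ct_eq_some.2 ⟨hΦ, hct⟩) hgs,
      happend _ hsub⟩
  | @optionalCls Ω Φ C L q R hsome ha hct hlast _ ih =>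
    exfalso
    cases ha with
    | group _ hmem => simp at hmem
    | none h1 h2 => exact h2 (hd.exists_alternatives hpl hct hsome h1)
  | @optionalRef Ω Φ C D R hsome ha hct _ ih =>
    obtain ⟨l, hl, gs, hgs, hsub⟩ := ih hv (hd.pred hpl fun s hs _ L => by simp [hct])
    refine ⟨_, List.mem_map.2 ⟨l, hl, rfl⟩, ?_⟩
    by_cases hΦ : Φ ∈ fs.toFinset
    · rw [QType.restrict_mk_of_mem hΦ]
      rw [← hpl.pred_derive hΦ] at hgs
      exact ⟨_, .ref (derive_ct_eq_some.2 ⟨hΦ, hct⟩) hgs, happend _ hsub⟩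
    · rw [QType.restrict_mk_of_notMem (hpl.nodup_rt C) hΦ]
      refine ⟨gs, hgs, ?_, fun hall => ?_⟩
      · simpa using hsub.1.trans (List.sublist_append_left _ _)
      · -- Without marked fields in the alternative, the absent refinement adds no fields.
        have hnil : D.fields = [] := by
          refine List.eq_nil_iff_forall_not_mem.2 fun F hF => ?_
          have := hall (F, true) (List.mem_append_right _ (List.mem_map.2 ⟨F, hF, rfl⟩))
          simp at this
        rw [hsub.2 fun F hF => hall F (List.mem_append_left _ hF)]
        simp [hnil]
  | @split Ω Φ C G R ha hlen _ ih =>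
    have hG : ∃ Ψ ∈ G, Ψ ∈ fs.toFinset := by
      cases ha with
      | alone _ => simp at hlen
      | group h _ => exact h.exhaustive _ hv
      | none _ _ => simp at hlen
    obtain ⟨Ψ, hΨ, hΨs⟩ := hG
    obtain ⟨l, hl, rest⟩ := ih Ψ hΨ (variant_cons.2 ⟨hΨs, hv⟩)
      (hd.mono fun s hs => (variant_cons.1 hs).2)
    exact ⟨l, List.mem_flatMap.2 ⟨Ψ, hΨ, hl⟩, rest⟩

/-- Every signature found in the derived program is one of those found in the product line. -/
theorem Mtype.derive (hpl : pl.WellTyped stupid) {m : MethodName} {q : QType} {S : List Sig}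
    (h : pl.Mtype Ω m q S) (hv : pl.fm.Variant Ω fs.toFinset) {σ : Sig}
    (hσ : (pl.derive fs).Mtype m (q.restrict pl.rt fs.toFinset) σ) : σ ∈ S := by
  have huniq : ∀ {Φ C d M M'}, pl.ct Φ C = some d → M ∈ d.methods → M' ∈ d.methods →
      M.name = M'.name → M = M' := fun hd hM hM' hname =>
    List.inj_on_of_nodup_map (hpl.table.noDuplicates _ _ _ hd).2.1 hM hM' hname
  have hlast' : ∀ {C q q'}, last pl.rt C = some q → last (pl.derive fs).rt C = some q' →
      q' = q.restrict pl.rt fs.toFinset := fun h h' => by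
    rw [hpl.restrict_last h, last_eq_lastOf hpl.derive_rt_object h']
  induction h with
  | base => cases hσ
  | @hereCls Φ C L M q S S' _ hct hM hname _ hlast _ ih ih' =>
    by_cases hΦ : Φ ∈ fs.toFinset
    · rw [QType.restrict_mk_of_mem hΦ] at hσ
      cases hσ with
      | here h hM' hname' =>
        cases Option.some.inj (hct.symm.trans (derive_ct_eq_some.1 h).2)
        rw [huniq hct hM' hM (hname'.trans hname.symm)]
        simp
      | cls h hno _ _ =>
        cases Option.some.inj (hct.symm.trans (derive_ct_eq_some.1 h).2)
        exact absurd hname (hno _ hM)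
      | ref h _ _ => cases Option.some.inj (hct.symm.trans (derive_ct_eq_some.1 h).2)
    · rw [QType.restrict_mk_of_notMem (hpl.nodup_rt C) hΦ] at hσ
      simp [ih hσ]
  | @hereRef Φ C R M S _ hct hM hname _ ih =>
    by_cases hΦ : Φ ∈ fs.toFinset
    · rw [QType.restrict_mk_of_mem hΦ] at hσ
      cases hσ with
      | here h hM' hname' =>
        cases Option.some.inj (hct.symm.trans (derive_ct_eq_some.1 h).2)
        rw [huniq hct hM' hM (hname'.trans hname.symm)]
        simp
      | cls h _ _ _ => cases Option.some.inj (hct.symm.trans (derive_ct_eq_some.1 h).2)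
      | ref h hno _ =>
        cases Option.some.inj (hct.symm.trans (derive_ct_eq_some.1 h).2)
        exact absurd hname (hno _ hM)
    · rw [QType.restrict_mk_of_notMem (hpl.nodup_rt C) hΦ] at hσ
      simp [ih hσ]
  | @skipCls Φ C L q S S' _ hct hno _ hlast _ ih ih' =>
    by_cases hΦ : Φ ∈ fs.toFinset
    · rw [QType.restrict_mk_of_mem hΦ] at hσ
      cases hσ with
      | here h hM' hname' =>
        cases Option.some.inj (hct.symm.trans (derive_ct_eq_some.1 h).2)
        exact absurd hname' (hno _ hM')
      | cls h _ hl hσ =>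
        cases Option.some.inj (hct.symm.trans (derive_ct_eq_some.1 h).2)
        rw [hlast' hlast hl] at hσ
        simp [ih' hσ]
      | ref h _ _ => cases Option.some.inj (hct.symm.trans (derive_ct_eq_some.1 h).2)
    · rw [QType.restrict_mk_of_notMem (hpl.nodup_rt C) hΦ] at hσ
      simp [ih hσ]
  | @skipRef Φ C R S _ hct hno _ ih =>
    by_cases hΦ : Φ ∈ fs.toFinset
    · rw [QType.restrict_mk_of_mem hΦ] at hσ
      cases hσ with
      | here h hM' hname' =>
        cases Option.some.inj (hct.symm.trans (derive_ct_eq_some.1 h).2)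
        exact absurd hname' (hno _ hM')
      | cls h _ _ _ => cases Option.some.inj (hct.symm.trans (derive_ct_eq_some.1 h).2)
      | ref h _ hσ =>
        rw [hpl.pred_derive hΦ] at hσ
        exact ih hσ
    · rw [QType.restrict_mk_of_notMem (hpl.nodup_rt C) hΦ] at hσ
      exact ih hσ
  | @never Φ C S hn _ ih =>
    rw [QType.restrict_mk_of_notMem (hpl.nodup_rt C) (hn _ hv)] at hσ
    exact ih hσ

theorem IntroduceField.derive (hpl : pl.WellTyped stupid) {f : FieldName} {q : QType}
    (h : pl.IntroduceField Ω f q) (hv : pl.fm.Variant Ω fs.toFinset)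
    (hd : pl.DeclaredUpTo Ω q) :
    (pl.derive fs).IntroduceField f (q.restrict pl.rt fs.toFinset) := by
  obtain ⟨R, hR, hno⟩ := h
  obtain ⟨l, hl, gs, hgs, hsub, -⟩ := hR.derive hpl hv hd
  refine ⟨gs, hgs, fun F hF => ?_⟩
  obtain ⟨F', hF', rfl⟩ := List.mem_map.1 (hsub.subset hF)
  exact hno l hl F' hF'

theorem IntroduceMethod.derive (hpl : pl.WellTyped stupid) {m : MethodName} {q : QType}
    (h : pl.IntroduceMethod Ω m q) (hv : pl.fm.Variant Ω fs.toFinset) :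
    (pl.derive fs).IntroduceMethod m (q.restrict pl.rt fs.toFinset) := by
  rintro ⟨σ, hσ⟩
  simpa using Mtype.derive hpl h hv hσ

theorem Override.derive (hpl : pl.WellTyped stupid) {Ψs : List Feature} {C : ClassName}
    {m : MethodName} {σ : Sig} (hΨs : Ψs <+: pl.rt C)
    (h : pl.Override Ω Ψs C m (lastOf Ψs C) σ) (hv : pl.fm.Variant Ω fs.toFinset) :
    (pl.derive fs).Override m ((lastOf Ψs C).restrict pl.rt fs.toFinset) σ := by
  obtain ⟨hvalid, S, hS, hall⟩ := h
  obtain ⟨σ', hσ'⟩ := (hvalid _ hv).exists_mtype hpl hv.1 hΨs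
  rw [← QType.restrict_lastOf (hpl.nodup_rt C) hΨs] at hσ'
  obtain rfl := hall _ (hS.derive hpl hv hσ')
  exact hσ'

/-! ### Typing in the derived program -/

/-- Choosing one possible type for every argument. -/
theorem exists_types {α β : Type*} {p : α → β → Prop} :
    ∀ {ts : List α} {Css : List (List β)}, ts.length = Css.length →
      (∀ x ∈ ts.zip Css, ∃ C ∈ x.2, p x.1 C) →
      ∃ Cs : List β, ts.length = Cs.length ∧ (∀ x ∈ ts.zip Cs, p x.1 x.2) ∧
        List.Forall₂ (fun C Ds => C ∈ Ds) Cs Css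
  | [], [], _, _ => ⟨[], rfl, by simp, .nil⟩
  | t :: ts, Ds :: Css, hlen, h => by
    obtain ⟨C, hC, hp⟩ := h (t, Ds) (by simp)
    obtain ⟨Cs, h1, h2, h3⟩ := exists_types (ts := ts) (Css := Css) (by simpa using hlen)
      fun x hx => h x (by simp [hx])
    refine ⟨C :: Cs, by simp [h1], ?_, .cons hC h3⟩
    simp only [List.zip_cons_cons, List.forall_mem_cons]
    exact ⟨hp, h2⟩

theorem forall_zip_of_forall₂ {β γ : Type*} {r : β → γ → Prop} :
    ∀ {Cs : List β} {Css : List (List β)} {l : List γ},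
      List.Forall₂ (fun C Ds => C ∈ Ds) Cs Css →
      (∀ x ∈ Css.zip l, ∀ C ∈ x.1, r C x.2) → ∀ x ∈ Cs.zip l, r x.1 x.2
  | _, _, [], _, _ => by simp
  | _, _, _ :: _, .nil, _ => by simp
  | _, _, _ :: _, .cons hC hs, h => by
    simp only [List.zip_cons_cons, List.forall_mem_cons] at h ⊢
    exact ⟨h.1 _ hC, forall_zip_of_forall₂ hs h.2⟩

/-- One of the possible types of a term is a type of it in the derived program. -/
theorem HasType.derive (hpl : pl.WellTyped stupid) {Γ : Ctx} {t : Term} {Es : List ClassName}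
    (h : pl.HasType stupid Γ Ω t Es) (hv : pl.fm.Variant Ω fs.toFinset) :
    ∃ E ∈ Es, (pl.derive fs).HasType stupid Γ t E := by
  induction h with
  | var hx => exact ⟨_, by simp, .var hx⟩
  | @field t₀ Es f R _ hvalid hR _ ih =>
    obtain ⟨E, hE, ht⟩ := ih
    have hC := (hvalid E hE).validClass hpl
    obtain ⟨q, hq, hF⟩ := hR E hE
    obtain ⟨l, hl, gs, hgs, hsub, -⟩ := hF.derive hpl hv (hC.declaredUpTo hpl hq)
    rw [hpl.restrict_last hq] at hgs
    obtain ⟨F, hFm, rfl⟩ := (hvalid E hE _ hv).mem_fields hpl hv.1 List.prefix_rfl hgs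
    refine ⟨F.ty, ?_, .field ht (hC.last_derive hpl hv) hgs hFm⟩
    obtain ⟨F', hF', rfl⟩ := List.mem_map.1 (hsub.subset hFm)
    exact List.mem_flatMap.2 ⟨E, hE, List.mem_flatMap.2 ⟨l, hl,
      List.mem_map.2 ⟨F', List.mem_filter.2 ⟨hF', by simp⟩, rfl⟩⟩⟩
  | @invk t₀ Es m S ts Css _ hvalid hS hlen _ hargs ih ih' =>
    obtain ⟨E, hE, ht⟩ := ih
    have hC := (hvalid E hE).validClass hpl
    obtain ⟨q, hq, hm⟩ := hS E hE
    obtain ⟨σ, hσ⟩ := (hvalid E hE _ hv).exists_mtype hpl hv.1 List.prefix_rfl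
    have hσS : σ ∈ S E := hm.derive hpl hv (by rw [hpl.restrict_last hq]; exact hσ)
    obtain ⟨hlen', hsub⟩ := hargs E hE σ hσS
    obtain ⟨Cs, h1, h2, h3⟩ := exists_types hlen ih'
    refine ⟨σ.ret, List.mem_flatMap.2 ⟨E, hE, List.mem_map.2 ⟨σ, hσS, rfl⟩⟩,
      .invk ht (hC.last_derive hpl hv) hσ h1 h2 (by omega) ?_⟩
    exact forall_zip_of_forall₂ h3 fun x hx C hC => (hsub x hx C hC).derive hpl hv
  | @new C q R ts Css hC hq hF hlen _ hargs ih =>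
    obtain ⟨l, hl, gs, hgs, -, heq⟩ := hF.derive hpl hv (hC.declaredUpTo hpl hq)
    rw [hpl.restrict_last hq] at hgs
    obtain ⟨hmark, hlen', hsub⟩ := hargs l hl
    obtain ⟨Cs, h1, h2, h3⟩ := exists_types hlen ih
    obtain rfl := heq hmark
    refine ⟨C, by simp, .new (hC.last_derive hpl hv) hgs h1 h2 (by simp; omega) ?_⟩
    refine forall_zip_of_forall₂ (r := fun B (F : FieldDecl) => (pl.derive fs).Sub B F.ty) h3 ?_
    intro x hx B hB
    rw [List.zip_map_right] at hx
    obtain ⟨y, hy, rfl⟩ := List.mem_map.1 hx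
    exact (hsub y hy B hB).derive hpl hv
  | @udcast t₀ Es C _ _ hsub ih =>
    obtain ⟨E, hE, ht⟩ := ih
    refine ⟨C, by simp, ?_⟩
    rcases hsub E hE with h | h
    · exact .ucast ht (h.derive hpl hv)
    · by_cases hCE : C = E
      · subst hCE
        exact .ucast ht (.refl _)
      · exact .dcast ht (h.derive hpl hv) hCE
  | @scast t₀ Es C hst _ _ _ ih =>
    -- The cast may be stupid only for a type of `t₀` that another variant gives to it.
    obtain ⟨E, hE, ht⟩ := ih
    refine ⟨C, by simp, ?_⟩
    by_cases h1 : (pl.derive fs).Sub E C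
    · exact .ucast ht h1
    by_cases h2 : (pl.derive fs).Sub C E
    · exact .dcast ht h2 fun hCE => h1 (hCE ▸ .refl _)
    · exact .scast hst ht h2 h1

theorem HasType.validClass_of_mentions {Γ : Ctx} {t : Term} {Es : List ClassName}
    (h : pl.HasType stupid Γ Ω t Es) {A : ClassName} (hA : t.Mentions A) :
    pl.ValidClass Ω A := by
  have hzip : ∀ {ts : List Term} {Css : List (List ClassName)} {u : Term},
      ts.length = Css.length → u ∈ ts → ∃ Cs, (u, Cs) ∈ ts.zip Css := by
    intro ts Css u hlen hu
    rw [← List.map_fst_zip hlen.le] at hu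
    obtain ⟨x, hx, rfl⟩ := List.mem_map.1 hu
    exact ⟨x.2, hx⟩
  induction h with
  | var _ => cases hA
  | field _ _ _ _ ih =>
    cases hA with
    | field hA => exact ih hA
  | invk _ _ _ hlen _ _ ih ih' =>
    cases hA with
    | invk hA => exact ih hA
    | invkArg hu hA =>
      obtain ⟨Cs, hx⟩ := hzip hlen hu
      exact ih' _ hx hA
  | new hC _ _ hlen _ _ ih =>
    cases hA with
    | new => exact hC
    | newArg hu hA =>
      obtain ⟨Cs, hx⟩ := hzip hlen hu
      exact ih _ hx hA
  | udcast _ hC _ ih | scast _ _ hC _ ih =>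
    cases hA with
    | cast => exact hC
    | castArg hA => exact ih hA

theorem MethodOK.bodyOK {Φ : Feature} {C : ClassName} {M : MethodDecl}
    (h : pl.MethodOK stupid Φ C M) : pl.BodyOK stupid Φ C M := by
  cases h <;> assumption

theorem BodyOK.derive (hpl : pl.WellTyped stupid) {Φ : Feature} {C : ClassName} {M : MethodDecl}
    (h : pl.BodyOK stupid Φ C M) (hv : pl.fm.Variant [Φ] fs.toFinset) :
    (pl.derive fs).BodyOK stupid C M := by
  obtain ⟨⟨Es, hEs, hsub⟩, -⟩ := h
  obtain ⟨E, hE, ht⟩ := hEs.derive hpl hv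
  exact ⟨E, ht, (hsub E hE).derive hpl hv⟩

theorem MethodOK.derive (hpl : pl.WellTyped stupid) {Φ : Feature} {C : ClassName}
    {M : MethodDecl} (h : pl.MethodOK stupid Φ C M) (hv : pl.fm.Variant [Φ] fs.toFinset) :
    (pl.derive fs).MethodOK stupid Φ C M := by
  have hΦ : Φ ∈ fs.toFinset := hv.2 Φ (by simp)
  have hb := h.bodyOK.derive hpl hv
  cases h with
  | clsIntro _ hct ho hlast hi =>
    have := hi.derive hpl hv
    rw [hpl.restrict_last hlast] at this
    exact .clsIntro hb (derive_ct_eq_some.2 ⟨hΦ, hct⟩) ho (hpl.last_super_derive hv.1 hΦ hct) this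
  | clsOverride _ hct ho hlast hi =>
    have hq := last_eq_lastOf hpl.rt_object hlast
    have := Override.derive hpl List.prefix_rfl (hq ▸ hi) hv
    rw [← hq, hpl.restrict_last hlast] at this
    exact .clsOverride hb (derive_ct_eq_some.2 ⟨hΦ, hct⟩) ho
      (hpl.last_super_derive hv.1 hΦ hct) this
  | refIntro _ hct ho hi =>
    have := hi.derive hpl hv
    rw [← hpl.pred_derive hΦ] at this
    exact .refIntro hb (derive_ct_eq_some.2 ⟨hΦ, hct⟩) ho this
  | refOverride _ hct ho hi =>
    have := Override.derive hpl (before_prefix _ _ _) hi hv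
    rw [← pred_eq_lastOf, ← hpl.pred_derive hΦ] at this
    exact .refOverride hb (derive_ct_eq_some.2 ⟨hΦ, hct⟩) ho this

theorem WellTyped.classOK_derive (hpl : pl.WellTyped stupid) (hfs : pl.fm.Valid fs) {Φ : Feature}
    {C : ClassName} {L : ClassDecl} (hΦ : Φ ∈ fs.toFinset) (hct : pl.ct Φ C = some (.cls L)) :
    (pl.derive fs).ClassOK stupid Φ L := by
  have hv : pl.fm.Variant [Φ] fs.toFinset := ⟨hfs, by simpa using hΦ⟩
  have hL := hpl.classes _ _ _ hct
  obtain ⟨q, hq, hF⟩ := hL.fields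
  refine ⟨fun M hM => (hL.methods M hM).derive hpl hv,
    ⟨_, hpl.last_super_derive hfs hΦ hct, fun F hFm => ?_⟩, ?_⟩
  · have := (hF F hFm).derive hpl hv (hL.super.declaredUpTo hpl hq)
    rwa [hpl.restrict_last hq] at this
  · rintro Ψ hne ⟨L', hL'⟩
    obtain ⟨hΨ, hL'⟩ := derive_ct_eq_some.1 hL'
    exact hL.introduce Ψ hne ⟨_, hv, hΨ⟩ ⟨L', hL'⟩

theorem WellTyped.refOK_derive (hpl : pl.WellTyped stupid) (hfs : pl.fm.Valid fs) {Φ : Feature}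
    {C : ClassName} {R : RefDecl} (hΦ : Φ ∈ fs.toFinset) (hct : pl.ct Φ C = some (.ref R)) :
    (pl.derive fs).RefOK stupid Φ R := by
  have hv : pl.fm.Variant [Φ] fs.toFinset := ⟨hfs, by simpa using hΦ⟩
  have hR := hpl.refinements _ _ _ hct
  obtain rfl : R.name = C := hpl.table.name_eq _ _ _ hct
  refine ⟨fun M hM => (hR.methods M hM).derive hpl hv, fun F hFm => ?_, ?_⟩
  · rw [hpl.pred_derive hΦ]
    refine (hR.fields F hFm).derive hpl hv ?_
    exact declaredUpTo_lastOf hpl (before_prefix _ _ _) fun s hs =>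
      hpl.exists_cls_before hs.1 (hs.2 Φ (by simp)) hct
  · obtain ⟨Ψ, h1, h2, L, hL⟩ := hpl.exists_cls_before hfs hΦ hct
    refine ⟨Ψ, ?_, L, derive_ct_eq_some.2 ⟨h2, hL⟩⟩
    rw [before_derive hΦ]
    exact List.mem_filter.2 ⟨h1, by simpa using h2⟩

/-! ### Sanity of the derived class table -/

/-- A class name that occurs in a declaration in the feature `Φ` is valid in every variant that
contains `Φ`. -/
theorem WellTyped.validClass_of_mentions (hpl : pl.WellTyped stupid) {Φ : Feature} {C : ClassName}
    {d : Decl} (hct : pl.ct Φ C = some d) {A : ClassName} (hA : d.Mentions A) :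
    pl.ValidClass [Φ] A := by
  have hmethod : ∀ {D : ClassName} {M : MethodDecl}, pl.MethodOK stupid Φ D M → M.Mentions A →
      pl.ValidClass [Φ] A := by
    intro D M hM hA
    obtain ⟨⟨Es, hEs, -⟩, hparams, hret⟩ := hM.bodyOK
    rcases hA with rfl | hA | hA
    · exact hret
    · exact hparams _ hA
    · exact hEs.validClass_of_mentions hA
  rcases hA with rfl | ⟨L, rfl, rfl⟩ | ⟨F, hF, rfl⟩ | ⟨M, hM, hA⟩
  · obtain rfl := hpl.table.name_eq _ _ _ hct
    exact .of_forall_exists_decl hpl fun s hs => ⟨Φ, hs.2 Φ (by simp), d, hct⟩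
  · exact (hpl.classes _ _ _ hct).super
  · cases d with
    | cls L => exact (hpl.classes _ _ _ hct).fieldTypes F hF
    | ref R => exact (hpl.refinements _ _ _ hct).fieldTypes F hF
  · cases d with
    | cls L => exact hmethod ((hpl.classes _ _ _ hct).methods M hM) hA
    | ref R => exact hmethod ((hpl.refinements _ _ _ hct).methods M hM) hA

theorem WellTyped.tableSane_derive (hpl : pl.WellTyped stupid) (hfs : pl.fm.Valid fs) :
    TableSane (pl.derive fs).ct where
  finite := hpl.table.finite.subset fun p hp => by
    obtain ⟨d, hd⟩ := Option.ne_none_iff_exists'.1 hp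
    simp [(derive_ct_eq_some.1 hd).2]
  name_eq Φ C d h := hpl.table.name_eq Φ C d (derive_ct_eq_some.1 h).2
  object_undeclared Φ := by
    simp [derive, ClassTable.select, hpl.table.object_undeclared]
  closed Φ C d h A hA := by
    obtain ⟨hΦ, hct⟩ := derive_ct_eq_some.1 h
    refine ((hpl.validClass_of_mentions hct hA).exists_cls hpl
      (fs := fs) ⟨hfs, by simpa using hΦ⟩).imp_right ?_
    rintro ⟨Ψ, hΨ, L, hL⟩
    exact ⟨Ψ, by simp [derive_ct_eq_some.2 ⟨hΨ, hL⟩]⟩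
  noDuplicates Φ C d h := hpl.table.noDuplicates Φ C d (derive_ct_eq_some.1 h).2

end ProductLine

end FFJ

/-- Correctness of the product-line type system: every program that is derived from a well-typed
product line with a valid feature selection is well-typed. With `stupid = false` this is the
version in which stupid casts are rejected, both in product lines and in programs. -/
theorem mainTheorem1 (stupid : Bool) (pl : FFJ.ProductLine) (hpl : pl.WellTyped stupid)
    (fs : List FFJ.Feature) (hfs : pl.fm.Valid fs) :
    (pl.derive fs).WellTyped stupid := by
  refine ⟨?_, fun Φ C L h => ?_, fun Φ C R h => ?_, hpl.tableSane_derive hfs,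
    hpl.acyclic _ hfs, hpl.refTableSane_derive hfs⟩
  · obtain ⟨Cs, hCs⟩ := hpl.term
    obtain ⟨C, -, hC⟩ := hCs.derive hpl ⟨hfs, by simp⟩
    exact ⟨C, hC⟩
  · obtain ⟨hΦ, hct⟩ := FFJ.ProductLine.derive_ct_eq_some.1 h
    exact hpl.classOK_derive hfs hΦ hct
  · obtain ⟨hΦ, hct⟩ := FFJ.ProductLine.derive_ct_eq_some.1 h
    exact hpl.refOK_derive hfs hΦ hct
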